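/- **Conventions.** An *index* is a finite tuple $\boldsymbol k=(k_1,\dots,k_r)$ of positive integers ($r\ge 0$), of weight $\mathrm{wt}(\boldsymbol k)=k_1+\cdots+k_r$; it is *admissible* if it is empty or $k_r\ge 2$. For admissible $\boldsymbol k$ let $\zeta(\boldsymbol k)=\sum_{0<n_1<\cdots<n_r}n_1^{-k_1}\cdots n_r^{-k_r}$, with $\zeta(\varnothing)=1$. Let $\mathcal Z$ be the $\mathbb Q$-subalgebra of $\mathbb R$ generated by all these values; note $\pi^2=6\zeta(2)\in\mathcal Z$. Let $\mathfrak H=\mathbb Q\langle x,y\rangle$ and $\mathfrak H^1=\mathbb Q+y\mathfrak H$, which has the $\mathbb Q$-basis $z_{\boldsymbol k}=z_{k_1}\cdots z_{k_r}$ ($\boldsymbol k$ an index), where $z_k=yx^{k-1}$ and $z_\varnothing=1$. The harmonic product $\ast$ on $\mathfrak H^1$ and the shuffle product ш on $\mathfrak H$ are the $\mathbb Q$-bilinear products with unit $1$ such that $$w_1z_a\ast w_2z_b=(w_1\ast w_2z_b)z_a+(w_1z_a\ast w_2)z_b+(w_1\ast w_2)z_{a+b}\qquad(w_1,w_2\in\mathfrak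 H^1,\ a,b\ge 1),$$ $$w_1u_1\,ш\,w_2u_2=(w_1\,ш\,w_2u_2)u_1+(w_1u_1\,ш\,w_2)u_2\qquad(w_1,w_2\in\mathfrak H,\ u_1,u_2\in\{x,y\});$$ ш restricts to $\mathfrak H^1$. For $\bullet\in\{\ast,ш\}$ let $Z^\bullet:\mathfrak H^1\to\mathcal Z[T]$ be the $\mathbb Q$-algebra homomorphism with respect to the product $\bullet$ on $\mathfrak H^1$ such that $Z^\bullet(z_{\boldsymbol k})=\zeta(\boldsymbol k)$ for all admissible $\boldsymbol k$ and $Z^\bullet(y)=T$, and let $\zeta^\bullet(\boldsymbol k)\in\mathcal Z$ be the value of $Z^\bullet(z_{\boldsymbol k})$ at $T=0$. For an index $\boldsymbol k=(k_1,\dots,k_r)$ put $$\zeta^\bullet_{\widehat{\mathcal S}}(\boldsymbol k)=\sum_{i=0}^r(-1)^{k_{i+1}+\cdots+k_r}\,\zeta^\bullet(k_1,\dots,k_i)\sum_{(l_{i+1},\dots,l_r)\in\mathbb Z_{\ge0}^{r-i}}\Bigl(\prod_{j=i+1}^r\binom{k_j+l_j-1}{l_j}\Bigr)\zeta^\bullet(k_r+l_r,\dots,k_{i+1}+l_{i+1})\,t^{\,l_{i+1}+\cdots+l_r}\in\mathcal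 Z[[t]].$$ **Proposition.** For each $\bullet\in\{\ast,ш\}$ the homomorphism $Z^\bullet$ exists and is unique, and for every index $\boldsymbol k$, $$\zeta^\ast_{\widehat{\mathcal S}}(\boldsymbol k)\equiv\zeta^{ш}_{\widehat{\mathcal S}}(\boldsymbol k)\pmod{\pi^2\mathcal Z[[t]]}.$$ Hence the images of $\zeta^\ast_{\widehat{\mathcal S}}(\boldsymbol k)$ and $\zeta^{ш}_{\widehat{\mathcal S}}(\boldsymbol k)$ in $(\mathcal Z/\pi^2\mathcal Z)[[t]]$ coincide, i.e. the $t$-adic symmetric multiple zeta value of $\boldsymbol k$ does not depend on the choice of the regularization. -/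

import Mathlib

open scoped PowerSeries Polynomial

noncomputable section

namespace SymMZV

/-! ### Indices -/

/-- An index: a finite tuple `(k₁, …, k_r)` of positive integers; `[]` is the empty index. -/
abbrev Index := List ℕ+

/-- The weight `k₁ + ⋯ + k_r`. -/
def wt (k : Index) : ℕ := (k.map (fun n => (n : ℕ))).sum

/-- An index is admissible if it is empty or if its last entry is at least `2`. -/
def Admissible (k : Index) : Prop := ∀ a ∈ k.getLast?, 2 ≤ (a : ℕ)

/-- The tuple `k + l`, for an index `k` and a tuple `l` of non-negative integers of the same
length. -/
def Index.shift (k : Index) (l : Fin k.length → ℕ) : Index :=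
  List.ofFn fun j => ⟨(k.get j : ℕ) + l j, Nat.add_pos_left (k.get j).pos _⟩

/-- The product of binomial coefficients `∏ⱼ binom (kⱼ + lⱼ - 1) lⱼ`. -/
def Index.b (k : Index) (l : Fin k.length → ℕ) : ℕ :=
  ∏ j, Nat.choose ((k.get j : ℕ) + l j - 1) (l j)

/-! ### Multiple zeta values and the algebra they generate -/

/-- The multiple zeta value `ζ(k) = ∑_{0 < n₁ < ⋯ < n_r} 1 / (n₁^{k₁} ⋯ n_r^{k_r})`. It is only
used for admissible `k`, for which the series of positive terms converges. For the empty index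
it is `1` (one empty tuple, empty product). -/
def mzv (k : Index) : ℝ :=
  ∑' n : {n : Fin k.length → ℕ // (∀ i, 0 < n i) ∧ StrictMono n},
    ∏ i, 1 / (n.1 i : ℝ) ^ (k.get i : ℕ)

/-- `𝒵`: the `ℚ`-subalgebra of `ℝ` generated by all multiple zeta values. -/
def mzvAlg : Subalgebra ℚ ℝ := Algebra.adjoin ℚ {a | ∃ k, Admissible k ∧ mzv k = a}

/-- `ζ(k)` for admissible `k`, as an element of `𝒵`. -/
def mzvZ (k : Index) (hk : Admissible k) : mzvAlg :=
  ⟨mzv k, Algebra.subset_adjoin ⟨k, hk, rfl⟩⟩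

theorem mzv_two : mzv [2] = Real.pi ^ 2 / 6 := by
  let e : {n : Fin ([2] : Index).length → ℕ // (∀ i, 0 < n i) ∧ StrictMono n} ≃ ℕ :=
    { toFun := fun n => n.1 ⟨0, by simp⟩ - 1
      invFun := fun m => ⟨fun _ => m + 1, fun _ => Nat.succ_pos m, fun i j h => by
        have hi := i.2
        have hj := j.2
        simp only [List.length_singleton] at hi hj
        have : i.1 < j.1 := h
        omega⟩
      left_inv := fun n => by
        apply Subtype.ext
        funext i
        have hi : i = ⟨0, by simp⟩ := by
          apply Fin.ext
          have := i.2
          simp only [List.length_singleton] at this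
          simp only
          omega
        subst hi
        have := n.2.1 ⟨0, by simp⟩
        simp only
        omega
      right_inv := fun m => by simp }
  have h1 : HasSum (fun n : ℕ => 1 / ((n + 1 : ℕ) : ℝ) ^ 2) (Real.pi ^ 2 / 6) := by
    have h := (hasSum_nat_add_iff' (f := fun n : ℕ => (1 : ℝ) / (n : ℝ) ^ 2) 1).2 hasSum_zeta_two
    simpa using h
  rw [mzv, ← e.symm.tsum_eq, ← h1.tsum_eq]
  congr 1
  funext m
  have hu : ∀ f : Fin ([2] : Index).length → ℝ, ∏ i, f i = f ⟨0, by simp⟩ := fun f => by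
    exact Fin.prod_univ_one f
  rw [hu]
  rfl

/-- `π²` as an element of `𝒵`. -/
def piSq : mzvAlg := ⟨Real.pi ^ 2, by
  have h : mzv [2] ∈ mzvAlg := Algebra.subset_adjoin ⟨[2], by simp [Admissible], rfl⟩
  have h6 := mzvAlg.smul_mem h 6
  rw [mzv_two] at h6
  have h7 : (6 : ℚ) • (Real.pi ^ 2 / 6) = Real.pi ^ 2 := by
    rw [Rat.smul_def]
    push_cast
    ring
  rwa [h7] at h6⟩

/-! ### The algebra `ℚ⟨x, y⟩` and the subalgebra `ℚ + y ℚ⟨x, y⟩` -/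

/-- The two letters. -/
inductive Letter
  | x
  | y

/-- `𝔥 = ℚ⟨x, y⟩`. -/
abbrev H := FreeAlgebra ℚ Letter

/-- The variable `x` of `𝔥`. -/
def X : H := FreeAlgebra.ι ℚ Letter.x

/-- The variable `y` of `𝔥`. -/
def Y : H := FreeAlgebra.ι ℚ Letter.y

/-- `𝔥¹ = ℚ + y 𝔥`. -/
def H1 : Subalgebra ℚ H where
  carrier := {w | ∃ (c : ℚ) (v : H), w = algebraMap ℚ H c + Y * v}
  mul_mem' := by
    rintro _ _ ⟨c, v, rfl⟩ ⟨d, u, rfl⟩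
    refine ⟨c * d, c • u + v * (algebraMap ℚ H d + Y * u), ?_⟩
    rw [map_mul, Algebra.smul_def]
    have := (Algebra.commutes c (Y : H))
    simp only [mul_add, add_mul, mul_assoc]
    rw [← mul_assoc Y _ u, ← this, mul_assoc]
    abel
  add_mem' := by
    rintro _ _ ⟨c, v, rfl⟩ ⟨d, u, rfl⟩
    refine ⟨c + d, v + u, ?_⟩
    rw [map_add, mul_add]
    abel
  algebraMap_mem' := fun c => ⟨c, 0, by simp⟩

/-- `z_n = y x^(n-1)`, an element of `𝔥¹`. -/
def zOne (n : ℕ+) : H1 := ⟨Y * X ^ ((n : ℕ) - 1), 0, X ^ ((n : ℕ) - 1), by simp⟩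

/-- `z_k = z_{k₁} ⋯ z_{k_r}`, with `z_∅ = 1`. -/
def z (k : Index) : H1 := (k.map zOne).prod

/-- The monomial of `𝔥` attached to a word. -/
def mono (w : List Letter) : H := (w.map (FreeAlgebra.ι ℚ)).prod

theorem basisFreeMonoid_apply (w : FreeMonoid Letter) :
    FreeAlgebra.basisFreeMonoid ℚ Letter w = mono w.toList := by
  simp [FreeAlgebra.basisFreeMonoid, FreeAlgebra.equivMonoidAlgebraFreeMonoid, mono,
    FreeMonoid.lift_apply]

/-- The word of the monomial `z_k`. -/
def wordOf (k : Index) : List Letter :=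
  (k.map fun n => Letter.y :: List.replicate ((n : ℕ) - 1) Letter.x).flatten

theorem coe_z (k : Index) : ((z k : H1) : H) = mono (wordOf k) := by
  induction k with
  | nil => simp [z, wordOf, mono]
  | cons a k ih =>
    have h : z (a :: k) = zOne a * z k := by simp [z]
    have h2 : wordOf (a :: k)
        = (Letter.y :: List.replicate ((a : ℕ) - 1) Letter.x) ++ wordOf k := by simp [wordOf]
    rw [h, h2, MulMemClass.coe_mul, ih]
    simp [mono, zOne, X, Y, mul_assoc]

theorem wordOf_injective : Function.Injective wordOf := by
  have key : ∀ (m n : ℕ) (k l : Index),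
      List.replicate m Letter.x ++ wordOf k = List.replicate n Letter.x ++ wordOf l →
      m = n ∧ wordOf k = wordOf l := by
    have hx : ∀ (k : Index) (w : List Letter), wordOf k ≠ Letter.x :: w := by
      intro k w
      cases k <;> simp [wordOf]
    intro m
    induction m with
    | zero =>
      intro n k l h
      cases n with
      | zero => simpa using h
      | succ n =>
        rw [List.replicate_succ] at h
        exact absurd h (hx k _)
    | succ m ih =>
      intro n k l h
      cases n with
      | zero =>
        rw [List.replicate_succ] at h
        exact absurd h.symm (hx l _)
      | succ n =>
        rw [List.replicate_succ, List.replicate_succ] at h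
        simp only [List.cons_append, List.cons.injEq, true_and] at h
        obtain ⟨h1, h2⟩ := ih n k l h
        exact ⟨by omega, h2⟩
  intro k
  induction k with
  | nil =>
    intro l h
    cases l with
    | nil => rfl
    | cons b l => simp [wordOf] at h
  | cons a k ih =>
    intro l h
    cases l with
    | nil => simp [wordOf] at h
    | cons b l =>
      have h' : List.replicate ((a : ℕ) - 1) Letter.x ++ wordOf k
          = List.replicate ((b : ℕ) - 1) Letter.x ++ wordOf l := by
        simpa [wordOf] using h
      obtain ⟨h1, h2⟩ := key _ _ _ _ h'
      have ha := a.pos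
      have hb := b.pos
      have hab : a = b := PNat.eq (by omega)
      rw [hab, ih h2]

/-- Every word that begins with `y` is the word of some `z_k`. -/
theorem exists_wordOf (w : List Letter) : ∃ k : Index, wordOf k = Letter.y :: w := by
  suffices h : ∃ (a : ℕ+) (k : Index), wordOf (a :: k) = Letter.y :: w by
    obtain ⟨a, k, h⟩ := h
    exact ⟨_, h⟩
  induction w with
  | nil => exact ⟨1, [], by simp [wordOf]⟩
  | cons u w ih =>
    obtain ⟨a, k, h⟩ := ih
    cases u with
    | x =>
      refine ⟨a + 1, k, ?_⟩
      have ha := a.pos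
      have h' : List.replicate ((a : ℕ) - 1) Letter.x ++ wordOf k = w := by
        simpa [wordOf] using h
      have e : ((a + 1 : ℕ+) : ℕ) - 1 = ((a : ℕ) - 1) + 1 := by
        rw [PNat.add_coe, PNat.one_coe]
        omega
      have : wordOf ((a + 1) :: k)
          = (Letter.y :: List.replicate (((a + 1 : ℕ+) : ℕ) - 1) Letter.x) ++ wordOf k := by
        simp [wordOf]
      rw [this, e, List.replicate_succ, ← h']
      simp
    | y =>
      refine ⟨1, a :: k, ?_⟩
      have : wordOf (1 :: a :: k) = Letter.y :: wordOf (a :: k) := by simp [wordOf]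
      rw [this, h]

theorem linearIndependent_z : LinearIndependent ℚ z := by
  apply LinearIndependent.of_comp H1.val.toLinearMap
  have h := (FreeAlgebra.basisFreeMonoid ℚ Letter).linearIndependent.comp
    (fun k => FreeMonoid.ofList (wordOf k))
    (fun k l h => wordOf_injective (FreeMonoid.ofList.injective h))
  have e : (FreeAlgebra.basisFreeMonoid ℚ Letter : FreeMonoid Letter → H) ∘
      (fun k => FreeMonoid.ofList (wordOf k)) = H1.val.toLinearMap ∘ z := by
    funext k
    simp [basisFreeMonoid_apply, coe_z]
  rwa [e] at h

theorem span_z : ⊤ ≤ Submodule.span ℚ (Set.range z) := by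
  have key : ∀ v : H, Y * v ∈ (Submodule.span ℚ (Set.range z)).map H1.val.toLinearMap := by
    intro v
    have hv : v ∈ Submodule.span ℚ (Set.range (FreeAlgebra.basisFreeMonoid ℚ Letter)) := by
      rw [Module.Basis.span_eq]
      trivial
    induction hv using Submodule.span_induction with
    | zero => simp
    | add a b _ _ ha hb =>
      rw [mul_add]
      exact Submodule.add_mem _ ha hb
    | smul c a _ ha =>
      rw [mul_smul_comm]
      exact Submodule.smul_mem _ _ ha
    | mem a ha =>
      obtain ⟨w, rfl⟩ := ha
      obtain ⟨k, hk⟩ := exists_wordOf w.toList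
      refine ⟨z k, Submodule.subset_span ⟨k, rfl⟩, ?_⟩
      rw [basisFreeMonoid_apply]
      change ((z k : H1) : H) = _
      rw [coe_z, hk]
      simp [mono, Y]
  rintro ⟨w, c, v, rfl⟩ -
  obtain ⟨u, hu, huv⟩ := key v
  have : (⟨algebraMap ℚ H c + Y * v, c, v, rfl⟩ : H1) = c • z [] + u := by
    apply Subtype.ext
    change algebraMap ℚ H c + Y * v = c • ((z [] : H1) : H) + (u : H)
    rw [coe_z, show (u : H) = Y * v from huv, Algebra.algebraMap_eq_smul_one]
    simp [wordOf, mono]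
  rw [this]
  exact Submodule.add_mem _ (Submodule.smul_mem _ _ (Submodule.subset_span ⟨[], rfl⟩)) hu

/-- The monomials `z_k`, for all indices `k`, form a basis of `𝔥¹`. -/
def zBasis : Module.Basis Index ℚ H1 := Module.Basis.mk linearIndependent_z span_z

/-! ### The harmonic product on `𝔥¹` -/

/-- The harmonic product of two monomials `z_k`, each given by the *reversed* list of its
entries, so that the recursion removes the rightmost `z_n`. -/
def harmonicRev : List ℕ+ → List ℕ+ → H1
  | [], l => z l.reverse
  | a :: k, [] => z (a :: k).reverse
  | a :: k, b :: l =>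
      harmonicRev k (b :: l) * zOne a + harmonicRev (a :: k) l * zOne b
        + harmonicRev k l * zOne (a + b)
termination_by k l => k.length + l.length

/-- The harmonic product, as a `ℚ`-bilinear map `𝔥¹ × 𝔥¹ → 𝔥¹`. -/
def harmonic : H1 →ₗ[ℚ] H1 →ₗ[ℚ] H1 :=
  zBasis.constr ℚ fun k => zBasis.constr ℚ fun l => harmonicRev k.reverse l.reverse

theorem harmonic_z (k l : Index) : harmonic (z k) (z l) = harmonicRev k.reverse l.reverse := by
  have h : ∀ k, z k = zBasis k := fun k => by simp [zBasis]
  rw [h, h, harmonic, Module.Basis.constr_basis, Module.Basis.constr_basis]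

theorem harmonic_one_left (l : Index) : harmonic (z []) (z l) = z l := by
  simp [harmonic_z, harmonicRev]

theorem harmonic_one_right (k : Index) : harmonic (z k) (z []) = z k := by
  rw [harmonic_z]
  cases h : k.reverse with
  | nil =>
    have : k = [] := by simpa using h
    simp [harmonicRev, this]
  | cons a k' =>
    have : k = (a :: k').reverse := by rw [← h, List.reverse_reverse]
    simp [harmonicRev, this]

theorem harmonic_mul (k l : Index) (a b : ℕ+) :
    harmonic (z k * zOne a) (z l * zOne b) =
      harmonic (z k) (z l * zOne b) * zOne a + harmonic (z k * zOne a) (z l) * zOne b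
        + harmonic (z k) (z l) * zOne (a + b) := by
  have h : ∀ (k : Index) a, z k * zOne a = z (k ++ [a]) := fun k a => by simp [z]
  simp only [h, harmonic_z, List.reverse_append, List.reverse_singleton, List.singleton_append]
  rw [harmonicRev]

/-! ### The shuffle product on `𝔥` and its restriction to `𝔥¹` -/

/-- The shuffle product of two words, each given by the *reversed* list of its letters, so that
the recursion removes the rightmost letter. -/
def shuffleRev : List Letter → List Letter → H
  | [], v => mono v.reverse
  | a :: u, [] => mono (a :: u).reverse
  | a :: u, b :: v =>
      shuffleRev u (b :: v) * FreeAlgebra.ι ℚ a + shuffleRev (a :: u) v * FreeAlgebra.ι ℚ b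
termination_by u v => u.length + v.length

/-- The shuffle product, as a `ℚ`-bilinear map `𝔥 × 𝔥 → 𝔥`. -/
def shuffle : H →ₗ[ℚ] H →ₗ[ℚ] H :=
  (FreeAlgebra.basisFreeMonoid ℚ Letter).constr ℚ fun u =>
    (FreeAlgebra.basisFreeMonoid ℚ Letter).constr ℚ fun v =>
      shuffleRev u.toList.reverse v.toList.reverse

theorem shuffle_mono (u v : List Letter) :
    shuffle (mono u) (mono v) = shuffleRev u.reverse v.reverse := by
  have hu := basisFreeMonoid_apply (FreeMonoid.ofList u)
  have hv := basisFreeMonoid_apply (FreeMonoid.ofList v)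
  rw [FreeMonoid.toList_ofList] at hu hv
  rw [← hu, ← hv, shuffle, Module.Basis.constr_basis, Module.Basis.constr_basis]
  simp

theorem mono_cons (a : Letter) (u : List Letter) :
    mono (a :: u) = FreeAlgebra.ι ℚ a * mono u := by simp [mono]

theorem shuffle_mul (u v : List Letter) (a b : Letter) :
    shuffle (mono u * FreeAlgebra.ι ℚ a) (mono v * FreeAlgebra.ι ℚ b) =
      shuffle (mono u) (mono v * FreeAlgebra.ι ℚ b) * FreeAlgebra.ι ℚ a
        + shuffle (mono u * FreeAlgebra.ι ℚ a) (mono v) * FreeAlgebra.ι ℚ b := by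
  have h : ∀ (u : List Letter) a, mono u * FreeAlgebra.ι ℚ a = mono (u ++ [a]) :=
    fun u a => by simp [mono]
  simp only [h, shuffle_mono, List.reverse_append, List.reverse_singleton, List.singleton_append]
  rw [shuffleRev]

theorem shuffle_one_left (v : List Letter) : shuffle (mono []) (mono v) = mono v := by
  simp [shuffle_mono, shuffleRev]

theorem shuffle_one_right (u : List Letter) : shuffle (mono u) (mono []) = mono u := by
  rw [shuffle_mono]
  cases h : u.reverse with
  | nil =>
    have : u = [] := by simpa using h
    simp [shuffleRev, this]
  | cons a u' =>
    have : u = (a :: u').reverse := by rw [← h, List.reverse_reverse]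
    simp [shuffleRev, this]

theorem shuffleRev_eq_Y_mul (u v : List Letter) (hu : u.getLast? ≠ some Letter.x)
    (hv : v.getLast? ≠ some Letter.x) (h : u ≠ [] ∨ v ≠ []) :
    ∃ w, shuffleRev u v = Y * w := by
  have base : ∀ v : List Letter, v.getLast? ≠ some Letter.x → v ≠ [] →
      ∃ w, mono v.reverse = Y * w := by
    intro v hv hne
    obtain ⟨v', c, rfl⟩ := (List.eq_nil_or_concat v).resolve_left hne
    cases c with
    | x => simp at hv
    | y => exact ⟨mono v'.reverse, by simp [mono_cons, Y]⟩
  have tail : ∀ (a : Letter) (u : List Letter), (a :: u).getLast? ≠ some Letter.x →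
      u.getLast? ≠ some Letter.x := by
    intro a u hu
    cases u with
    | nil => simp
    | cons b u => rwa [List.getLast?_cons_cons] at hu
  induction u, v using shuffleRev.induct with
  | case1 v =>
    rw [shuffleRev]
    exact base v hv (by simpa using h)
  | case2 a u =>
    rw [shuffleRev]
    exact base _ hu (by simp)
  | case3 a u b v ih1 ih2 =>
    obtain ⟨w1, h1⟩ := ih1 (tail a u hu) hv (by simp)
    obtain ⟨w2, h2⟩ := ih2 hu (tail b v hv) (by simp)
    rw [shuffleRev, h1, h2]
    exact ⟨w1 * FreeAlgebra.ι ℚ a + w2 * FreeAlgebra.ι ℚ b, by rw [mul_add, mul_assoc, mul_assoc]⟩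

theorem wordOf_head (k : Index) : (wordOf k).reverse.getLast? ≠ some Letter.x := by
  cases k <;> simp [wordOf]

theorem shuffle_mem (w₁ w₂ : H1) : shuffle (w₁ : H) (w₂ : H) ∈ H1 := by
  have h1 : w₁ ∈ Submodule.span ℚ (Set.range z) := span_z trivial
  have h2 : w₂ ∈ Submodule.span ℚ (Set.range z) := span_z trivial
  induction h1, h2 using Submodule.span_induction₂ with
  | mem_mem a b ha hb =>
    obtain ⟨k, rfl⟩ := ha
    obtain ⟨l, rfl⟩ := hb
    rw [coe_z, coe_z, shuffle_mono]
    by_cases h : (wordOf k).reverse ≠ [] ∨ (wordOf l).reverse ≠ []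
    · obtain ⟨w, hw⟩ := shuffleRev_eq_Y_mul _ _ (wordOf_head k) (wordOf_head l) h
      rw [hw]
      exact ⟨0, w, by simp⟩
    · push Not at h
      rw [h.1, h.2, shuffleRev]
      simp [mono]
  | zero_left b hb => simp
  | zero_right a ha => simp
  | add_left a b c _ _ _ h1 h2 => simpa using H1.add_mem h1 h2
  | add_right a b c _ _ _ h1 h2 => simpa using H1.add_mem h1 h2
  | smul_left r a b _ _ h => simpa using H1.smul_mem h r
  | smul_right r a b _ _ h => simpa using H1.smul_mem h r

/-- The restriction of the shuffle product to `𝔥¹`. -/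
def shuffleH1 : H1 →ₗ[ℚ] H1 →ₗ[ℚ] H1 :=
  LinearMap.mk₂ ℚ (fun w₁ w₂ => ⟨shuffle (w₁ : H) (w₂ : H), shuffle_mem w₁ w₂⟩)
    (fun a b c => Subtype.ext (by simp)) (fun r a b => Subtype.ext (by simp))
    (fun a b c => Subtype.ext (by simp)) (fun r a b => Subtype.ext (by simp))

/-! ### Regularized multiple zeta values -/

/-- The two symbols `•`. -/
inductive Kind
  | harmonic
  | shuffle

/-- The product `•` on `𝔥¹`. -/
def Kind.prod : Kind → (H1 →ₗ[ℚ] H1 →ₗ[ℚ] H1)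
  | .harmonic => SymMZV.harmonic
  | .shuffle => shuffleH1

/-- `Z : 𝔥¹ → 𝒵[T]` is a homomorphism of `ℚ`-algebras from `𝔥¹` with the product `•` to `𝒵[T]`,
it extends `z_k ↦ ζ(k)` (`k` admissible), and it sends `y = z_1` to `T`. -/
structure IsRegularization (s : Kind) (Z : H1 →ₗ[ℚ] mzvAlg[X]) : Prop where
  map_one : Z 1 = 1
  map_prod : ∀ w₁ w₂ : H1, Z (s.prod w₁ w₂) = Z w₁ * Z w₂
  map_admissible : ∀ (k : Index) (hk : Admissible k), Z (z k) = Polynomial.C (mzvZ k hk)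
  map_y : Z (z [1]) = Polynomial.X

/-- The homomorphism `Z^•`, i.e. the one map (existence and uniqueness are theorems) that
satisfies `IsRegularization`. -/
def regHom (s : Kind) : H1 →ₗ[ℚ] mzvAlg[X] := Classical.epsilon (IsRegularization s)

/-- The polynomial `ζ^•(k; T) = Z^•(z_k)`. -/
def zetaRegPoly (s : Kind) (k : Index) : mzvAlg[X] := regHom s (z k)

/-- The regularized multiple zeta value `ζ^•(k) = ζ^•(k; 0)`. -/
def zetaReg (s : Kind) (k : Index) : mzvAlg := (zetaRegPoly s k).eval 0

/-! ### The `t`-adic symmetric multiple zeta values -/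

/-- The series `∑_l b(k, l) ζ^•(reverse of k + l) t^{wt l}`, with `l` running through all tuples
of non-negative integers of the length of `k`; `antidiagonalTuple r n` is the finite set of the
tuples in `ℕ^r` with sum `n`. -/
def tailSeries (s : Kind) (k : Index) : mzvAlg⟦X⟧ :=
  PowerSeries.mk fun n => ∑ l ∈ Finset.Nat.antidiagonalTuple k.length n,
    (k.b l : mzvAlg) * zetaReg s (k.shift l).reverse

/-- `ζ^•_Ŝ(k) = ∑_{i=0}^r (-1)^{wt(k^{[i]})} ζ^•(k_{[i]}) ∑_l b(k^{[i]}, l)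
ζ^•(reverse of k^{[i]} + l) t^{wt l}`, where `k_{[i]} = (k₁, …, k_i)` and
`k^{[i]} = (k_{i+1}, …, k_r)`. -/
def zetaS (s : Kind) (k : Index) : mzvAlg⟦X⟧ :=
  ∑ i ∈ Finset.range (k.length + 1),
    (-1) ^ wt (k.drop i) * PowerSeries.C (zetaReg s (k.take i)) * tailSeries s (k.drop i)

/-- `π² 𝒵`, as an ideal of `𝒵`. -/
def piSqIdeal : Ideal mzvAlg := Ideal.span {piSq}

/-- `π² 𝒵⟦t⟧`, as an ideal of `𝒵⟦t⟧`. -/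
def piSqIdealSeries : Ideal mzvAlg⟦X⟧ := Ideal.span {PowerSeries.C piSq}

/-- The image of `ζ^•_Ŝ(k)` in `(𝒵/π²𝒵)⟦t⟧`. -/
def zetaSBar (s : Kind) (k : Index) : (mzvAlg ⧸ piSqIdeal)⟦X⟧ :=
  PowerSeries.map (Ideal.Quotient.mk piSqIdeal) (zetaS s k)

end SymMZV

end

/-!
Every word of `𝔥¹` is a combination of products `w • y ^ n` with `w` admissible, because `• y` is an
antiderivative for the removal `∂` of a trailing `y`; hence `Z^•` is unique and satisfies
`Z^• ∘ ∂ = d/dT ∘ Z^•`. Existence comes from two models: truncated sums are multiplicative for `∗`,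
polylogarithms near `1` are multiplicative for `ш`, and their asymptotic expansions in the divergent
quantity are the polynomials `Z^•`. An Abelian theorem compares the two models, so `Z^ш` is the
image of `Z^∗` under a linear map commuting with `d/dT`, and at `T = 0` this becomes
`ζ^∗(w) = ∑ j, ζ^ш(∂^j w) ζ^∗(1, …, 1)`, with `j` ones.

By Newton's identities the generating series `f` of the values `ζ^∗(1, …, 1)` satisfies `f' = p f`,
where the coefficients of odd degree of `p` are even zeta values up to sign and vanish modulo `π²`,
so `f(t) f(-t) = 1` modulo `π²`. In `ζ^•_Ŝ(k)` both factors of every cut are corrected by `f(∂)`,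
and the alternating sum over the cuts turns `∂` on one factor into `-∂` on the other, so the total
correction is `f(∂) f(-∂) = 1`.
-/

noncomputable section

namespace SymMZV

open Filter Topology

theorem zBasis_apply (k : Index) : zBasis k = z k := by simp [zBasis]

theorem z_nil : z [] = 1 := rfl

theorem z_singleton (a : ℕ+) : z [a] = zOne a := by simp [z]

theorem z_reverse_cons (a : ℕ+) (r : List ℕ+) : z (a :: r).reverse = z r.reverse * zOne a := by
  simp [z]

theorem H1_hom_ext {M : Type*} [AddCommMonoid M] [Module ℚ M] {f g : H1 →ₗ[ℚ] M}
    (h : ∀ r : List ℕ+, f (z r.reverse) = g (z r.reverse)) : f = g :=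
  zBasis.ext fun k => by simpa [zBasis_apply] using h k.reverse

theorem eq_top_of_z_mem {V : Submodule ℚ H1} (h : ∀ r : List ℕ+, z r.reverse ∈ V) : V = ⊤ :=
  top_le_iff.1 <| span_z.trans <| Submodule.span_le.2 <| by
    rintro _ ⟨k, rfl⟩
    simpa using h k.reverse

theorem mono_nil : mono [] = 1 := rfl

theorem mono_singleton (a : Letter) : mono [a] = FreeAlgebra.ι ℚ a := by simp [mono]

theorem mono_reverse_cons (a : Letter) (u : List Letter) :
    mono (a :: u).reverse = mono u.reverse * FreeAlgebra.ι ℚ a := by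
  simp [mono]

theorem H_hom_ext {M : Type*} [AddCommMonoid M] [Module ℚ M] {f g : H →ₗ[ℚ] M}
    (h : ∀ u : List Letter, f (mono u.reverse) = g (mono u.reverse)) : f = g :=
  (FreeAlgebra.basisFreeMonoid ℚ Letter).ext fun u => by
    simpa [basisFreeMonoid_apply] using h u.toList.reverse

/-! ### Removal of a trailing `y` -/

/-- The linear map `w y ↦ w`, `w x ↦ 0`, `1 ↦ 0` of `𝔥`. -/
def delH : H →ₗ[ℚ] H :=
  (FreeAlgebra.basisFreeMonoid ℚ Letter).constr ℚ fun u =>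
    match u.toList.reverse with
    | Letter.y :: v => mono v.reverse
    | _ => 0

theorem delH_mono (u : List Letter) :
    delH (mono u.reverse) = match u with
      | Letter.y :: v => mono v.reverse
      | _ => 0 := by
  have hu := basisFreeMonoid_apply (FreeMonoid.ofList u.reverse)
  rw [FreeMonoid.toList_ofList] at hu
  rw [← hu, delH, Module.Basis.constr_basis, FreeMonoid.toList_ofList, List.reverse_reverse]

theorem delH_one : delH 1 = 0 := delH_mono []

theorem delH_mul_x (w : H) : delH (w * FreeAlgebra.ι ℚ Letter.x) = 0 :=
  have h : delH ∘ₗ LinearMap.mulRight ℚ (FreeAlgebra.ι ℚ Letter.x) = 0 := H_hom_ext fun u => by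
    rw [LinearMap.comp_apply, LinearMap.mulRight_apply, ← mono_reverse_cons, delH_mono,
      LinearMap.zero_apply]
  LinearMap.congr_fun h w

theorem delH_mul_y (w : H) : delH (w * FreeAlgebra.ι ℚ Letter.y) = w :=
  have h : delH ∘ₗ LinearMap.mulRight ℚ (FreeAlgebra.ι ℚ Letter.y) = LinearMap.id :=
    H_hom_ext fun u => by
      rw [LinearMap.comp_apply, LinearMap.mulRight_apply, ← mono_reverse_cons, delH_mono,
        LinearMap.id_apply]
  LinearMap.congr_fun h w

/-- The restriction of `delH` to `𝔥¹`. -/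
def del : H1 →ₗ[ℚ] H1 := zBasis.constr ℚ fun k =>
  match k.reverse with
  | a :: r => if a = 1 then z r.reverse else 0
  | [] => 0

theorem del_z (r : List ℕ+) :
    del (z r.reverse) = match r with
      | a :: r => if a = 1 then z r.reverse else 0
      | [] => 0 := by
  rw [← zBasis_apply, del, Module.Basis.constr_basis, List.reverse_reverse]

theorem del_one : del 1 = 0 := del_z []

theorem del_mul_zOne (w : H1) (a : ℕ+) : del (w * zOne a) = if a = 1 then w else 0 := by
  have h : del ∘ₗ LinearMap.mulRight ℚ (zOne a) = if a = 1 then LinearMap.id else 0 :=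
    H1_hom_ext fun r => by
      rw [LinearMap.comp_apply, LinearMap.mulRight_apply, ← z_reverse_cons, del_z]
      dsimp only
      split_ifs <;> rfl
  have := LinearMap.congr_fun h w
  split_ifs at this ⊢ <;> exact this

theorem coe_zOne_one : (zOne 1 : H) = FreeAlgebra.ι ℚ Letter.y := by simp [zOne, Y]

theorem coe_zOne_of_ne_one {a : ℕ+} (ha : a ≠ 1) :
    ∃ v : H, (zOne a : H) = v * FreeAlgebra.ι ℚ Letter.x := by
  obtain ⟨b, rfl⟩ := PNat.exists_eq_succ_of_ne_one ha
  refine ⟨Y * X ^ ((b : ℕ) - 1), ?_⟩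
  have hb : ((b + 1 : ℕ+) : ℕ) - 1 = (b : ℕ) - 1 + 1 := by
    have := b.pos
    rw [PNat.add_coe, PNat.one_coe]
    omega
  simp only [zOne, hb, pow_succ, X, mul_assoc]

theorem coe_del (w : H1) : (del w : H) = delH w := by
  refine LinearMap.congr_fun (f := H1.val.toLinearMap ∘ₗ del)
    (g := delH ∘ₗ H1.val.toLinearMap) (H1_hom_ext fun r => ?_) w
  change (del (z r.reverse) : H) = delH (z r.reverse : H1)
  cases r with
  | nil => simp [z_nil, del_one, delH_one]
  | cons a r =>
    rw [z_reverse_cons, del_mul_zOne, MulMemClass.coe_mul]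
    split_ifs with ha
    · rw [ha, coe_zOne_one, delH_mul_y]
    · obtain ⟨v, hv⟩ := coe_zOne_of_ne_one ha
      rw [hv, ← mul_assoc, delH_mul_x]
      rfl

theorem shuffle_y (a : Letter) (u : List Letter) :
    shuffle (mono (a :: u).reverse) (mono [Letter.y]) =
      shuffle (mono u.reverse) (mono [Letter.y]) * FreeAlgebra.ι ℚ a +
        mono (a :: u).reverse * mono [Letter.y] := by
  have h := shuffle_mul u.reverse [] a Letter.y
  rwa [← mono_reverse_cons, mono_nil, one_mul, ← mono_nil, shuffle_one_right,
    ← mono_singleton] at h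

theorem delH_shuffle_y (w : H) :
    delH (shuffle w (mono [Letter.y])) = shuffle (delH w) (mono [Letter.y]) + w := by
  refine LinearMap.congr_fun (f := delH ∘ₗ shuffle.flip (mono [Letter.y]))
    (g := shuffle.flip (mono [Letter.y]) ∘ₗ delH + LinearMap.id) (H_hom_ext fun u => ?_) w
  simp only [LinearMap.comp_apply, LinearMap.add_apply, LinearMap.flip_apply, LinearMap.id_apply]
  cases u with
  | nil =>
    rw [List.reverse_nil, shuffle_one_left, mono_nil, delH_one, map_zero, LinearMap.zero_apply,
      zero_add, mono_singleton, ← one_mul (FreeAlgebra.ι ℚ Letter.y), delH_mul_y]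
  | cons a u =>
    rw [shuffle_y, mono_singleton, map_add, delH_mul_y, mono_reverse_cons]
    cases a with
    | x => rw [delH_mul_x, delH_mul_x, map_zero, LinearMap.zero_apply]
    | y => rw [delH_mul_y, delH_mul_y]

theorem harmonic_y (a : ℕ+) (r : List ℕ+) :
    harmonic (z (a :: r).reverse) (z [1]) =
      harmonic (z r.reverse) (z [1]) * zOne a + z (a :: r).reverse * z [1] +
        z r.reverse * zOne (a + 1) := by
  have h := harmonic_mul r.reverse [] a 1
  rwa [z_nil, one_mul, ← z_singleton 1, ← z_nil, harmonic_one_right, ← z_reverse_cons,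
    harmonic_one_right] at h

theorem del_harmonic_y (w : H1) :
    del (harmonic w (z [1])) = harmonic (del w) (z [1]) + w := by
  refine LinearMap.congr_fun (f := del ∘ₗ harmonic.flip (z [1]))
    (g := harmonic.flip (z [1]) ∘ₗ del + LinearMap.id) (H1_hom_ext fun r => ?_) w
  simp only [LinearMap.comp_apply, LinearMap.add_apply, LinearMap.flip_apply, LinearMap.id_apply]
  cases r with
  | nil =>
    rw [List.reverse_nil, harmonic_one_left, z_nil, del_one, map_zero, LinearMap.zero_apply,
      zero_add, z_singleton, ← one_mul (zOne 1), del_mul_zOne, if_pos rfl]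
  | cons a r =>
    have ha : a + 1 ≠ 1 := (PNat.lt_add_left 1 a).ne'
    rw [harmonic_y, map_add, map_add, z_singleton, del_mul_zOne, del_mul_zOne, del_mul_zOne,
      if_neg ha, if_pos rfl, add_zero, z_reverse_cons, del_mul_zOne]
    split_ifs <;> simp

theorem del_prod_y (s : Kind) (w : H1) :
    del (s.prod w (z [1])) = s.prod (del w) (z [1]) + w := by
  cases s with
  | harmonic => exact del_harmonic_y w
  | shuffle =>
    have hy : (z [1] : H) = mono [Letter.y] := coe_z [1]
    apply Subtype.ext
    change (del (shuffleH1 w (z [1])) : H) = shuffle (del w : H) (z [1] : H1) + w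
    rw [coe_del, coe_del, hy, ← delH_shuffle_y, ← hy]
    rfl

theorem del_pow_z (r : List ℕ+) : (del ^ (r.length + 1)) (z r.reverse) = 0 := by
  induction r with
  | nil => simp [z_nil, del_one]
  | cons a r ih =>
    rw [List.length_cons, pow_succ, Module.End.mul_apply, z_reverse_cons, del_mul_zOne]
    split_ifs
    · exact ih
    · exact map_zero _

theorem maxGenEigenspace_del : Module.End.maxGenEigenspace del 0 = ⊤ := by
  refine eq_top_of_z_mem fun r => ?_
  rw [Module.End.mem_maxGenEigenspace, zero_smul, (sub_zero del : del - 0 = del)]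
  exact ⟨r.length + 1, del_pow_z r⟩

theorem admissible_nil : Admissible [] := by simp [Admissible]

theorem admissible_reverse_cons (a : ℕ+) (r : List ℕ+) :
    Admissible (a :: r).reverse ↔ a ≠ 1 := by
  have : 2 ≤ (a : ℕ) ↔ a ≠ 1 := by
    rw [Ne, ← PNat.coe_eq_one_iff]
    have := a.pos
    omega
  simp [Admissible, this]

theorem ker_del_le {V : Submodule ℚ H1} (hV : ∀ k, Admissible k → z k ∈ V) :
    LinearMap.ker del ≤ V := by
  have h : V.comap (LinearMap.id - LinearMap.mulRight ℚ (zOne 1) ∘ₗ del) = ⊤ := by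
    refine eq_top_of_z_mem fun r => ?_
    rw [Submodule.mem_comap]
    change z r.reverse - del (z r.reverse) * zOne 1 ∈ V
    cases r with
    | nil => simpa [z_nil, del_one] using hV [] admissible_nil
    | cons a r =>
      rw [z_reverse_cons, del_mul_zOne]
      split_ifs with ha
      · simp [ha]
      · rw [zero_mul, sub_zero, ← z_reverse_cons]
        exact hV _ ((admissible_reverse_cons a r).2 ha)
  intro w hw
  have hw' : w - del w * zOne 1 ∈ V := (Submodule.eq_top_iff'.1 h) w
  rwa [LinearMap.mem_ker.1 hw, zero_mul, sub_zero] at hw'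

section Weyl

theorem mul_pow_succ_of_mul_eq_mul_add_one {R : Type*} [Semiring R] {D Y : R}
    (h : D * Y = Y * D + 1) (m : ℕ) : D * Y ^ (m + 1) = Y ^ (m + 1) * D + (m + 1) • Y ^ m := by
  induction m with
  | zero => simp [h]
  | succ m ih =>
    rw [pow_succ, ← mul_assoc, ih, add_mul, mul_assoc, h, mul_add, mul_one, ← mul_assoc,
      smul_mul_assoc, ← pow_succ, ← pow_succ, add_assoc, ← succ_nsmul']

variable {K M : Type*} [Field K] [AddCommGroup M] [Module K M] {D Y : Module.End K M}

theorem pow_apply_pow_apply_of_apply_eq_zero (h : D * Y = Y * D + 1) {v : M} (hv : D v = 0)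
    (m : ℕ) : (D ^ m) ((Y ^ m) v) = m.factorial • v := by
  induction m with
  | zero => simp
  | succ m ih =>
    have hDY : D ((Y ^ (m + 1)) v) = (m + 1) • (Y ^ m) v := by
      simpa [hv, -nsmul_eq_mul] using LinearMap.congr_fun (mul_pow_succ_of_mul_eq_mul_add_one h m) v
    rw [pow_succ D, Module.End.mul_apply, hDY, map_nsmul, ih, smul_smul, Nat.factorial_succ]

theorem eq_top_of_ker_le_of_mapsTo [CharZero K] (h : D * Y = Y * D + 1)
    (hD : D.maxGenEigenspace 0 = ⊤) {V : Submodule K M} (hker : LinearMap.ker D ≤ V)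
    (hY : ∀ v ∈ V, Y v ∈ V) : V = ⊤ := by
  have hYpow : ∀ (m : ℕ), ∀ v ∈ V, (Y ^ m) v ∈ V := fun m v hv => by
    induction m with
    | zero => exact hv
    | succ m ih => rw [pow_succ', Module.End.mul_apply]; exact hY _ ih
  have hpow : ∀ (m : ℕ) (w : M), (D ^ m) w = 0 → w ∈ V := fun m => by
    induction m with
    | zero => rintro w (rfl : w = 0); exact V.zero_mem
    | succ m ih =>
      intro w hw
      -- `v` is the leading coefficient of `w`, viewed as a polynomial in `Y` over `ker D`.
      set v := (m.factorial : K)⁻¹ • (D ^ m) w with hv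
      have hDv : D v = 0 := by
        rw [hv, map_smul, ← Module.End.mul_apply, ← pow_succ', hw, smul_zero]
      have hsub : (D ^ m) (w - (Y ^ m) v) = 0 := by
        have hm : (m.factorial : K) ≠ 0 := Nat.cast_ne_zero.2 m.factorial_ne_zero
        rw [map_sub, pow_apply_pow_apply_of_apply_eq_zero h hDv, hv, ← Nat.cast_smul_eq_nsmul K,
          smul_inv_smul₀ hm, sub_self]
      simpa using V.add_mem (ih _ hsub) (hYpow m v (hker hDv))
  refine eq_top_iff.2 fun w _ => ?_
  obtain ⟨m, hm⟩ := Module.End.mem_maxGenEigenspace _ _ _ |>.1 (hD ▸ Submodule.mem_top : w ∈ _)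
  exact hpow m w (by simpa using hm)

end Weyl

theorem eq_top_of_admissible_of_prod_y (s : Kind) {V : Submodule ℚ H1}
    (hadm : ∀ k, Admissible k → z k ∈ V) (hy : ∀ w ∈ V, s.prod w (z [1]) ∈ V) : V = ⊤ :=
  eq_top_of_ker_le_of_mapsTo (D := del) (Y := s.prod.flip (z [1]))
    (LinearMap.ext (del_prod_y s)) maxGenEigenspace_del (ker_del_le hadm) hy

theorem map_prod_of_map_prod_z {A : Type*} [CommSemiring A] [Algebra ℚ A] {f : H1 →ₗ[ℚ] A}
    {μ : H1 →ₗ[ℚ] H1 →ₗ[ℚ] H1}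
    (h : ∀ r t : List ℕ+, f (μ (z r.reverse) (z t.reverse)) = f (z r.reverse) * f (z t.reverse))
    (u v : H1) : f (μ u v) = f u * f v :=
  LinearMap.congr_fun₂ (f := μ.compr₂ f) (g := (LinearMap.mul ℚ A).compl₁₂ f f)
    (H1_hom_ext fun r => H1_hom_ext fun t => h r t) u v

/-! ### Truncated multiple zeta values -/

/-- The truncated multiple zeta value `∑_{0 < n₁ < ⋯ < n_r ≤ N} ∏ 1 / nᵢ^{kᵢ}` of the index whose
reversal is the given list. -/
def hsum : List ℕ+ → ℕ → ℝ
  | [], _ => 1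
  | a :: r, N => ∑ m ∈ Finset.range N, hsum r m / ((m : ℝ) + 1) ^ (a : ℕ)

theorem hsum_nil (N : ℕ) : hsum [] N = 1 := rfl

theorem hsum_cons_succ (a : ℕ+) (r : List ℕ+) (N : ℕ) :
    hsum (a :: r) (N + 1) = hsum (a :: r) N + hsum r N / ((N : ℝ) + 1) ^ (a : ℕ) :=
  Finset.sum_range_succ _ _

theorem hsum_nonneg (r : List ℕ+) (N : ℕ) : 0 ≤ hsum r N := by
  induction r generalizing N with
  | nil => exact zero_le_one
  | cons a r ih => exact Finset.sum_nonneg fun m _ => div_nonneg (ih m) (by positivity)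

/-- The linear map on `𝔥¹` that sends `z_k` to the truncated multiple zeta value of `k`. -/
def trunc (N : ℕ) : H1 →ₗ[ℚ] ℝ := zBasis.constr ℚ fun k => hsum k.reverse N

theorem trunc_z (N : ℕ) (r : List ℕ+) : trunc N (z r.reverse) = hsum r N := by
  rw [← zBasis_apply, trunc, Module.Basis.constr_basis, List.reverse_reverse]

theorem trunc_mul_zOne (N : ℕ) (w : H1) (a : ℕ+) :
    trunc N (w * zOne a) = ∑ m ∈ Finset.range N, trunc m w / ((m : ℝ) + 1) ^ (a : ℕ) := by
  have h : trunc N ∘ₗ LinearMap.mulRight ℚ (zOne a) =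
      ∑ m ∈ Finset.range N, (((m : ℝ) + 1) ^ (a : ℕ))⁻¹ • trunc m := H1_hom_ext fun r => by
    rw [LinearMap.comp_apply, LinearMap.mulRight_apply, ← z_reverse_cons, trunc_z, hsum]
    simp [trunc_z, div_eq_inv_mul]
  simpa [div_eq_inv_mul] using LinearMap.congr_fun h w

theorem trunc_zero_mul_zOne (w : H1) (a : ℕ+) : trunc 0 (w * zOne a) = 0 := by
  simp [trunc_mul_zOne]

theorem trunc_succ_mul_zOne (N : ℕ) (w : H1) (a : ℕ+) :
    trunc (N + 1) (w * zOne a) = trunc N (w * zOne a) + trunc N w / ((N : ℝ) + 1) ^ (a : ℕ) := by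
  simp only [trunc_mul_zOne, Finset.sum_range_succ]

theorem trunc_harmonicRev (k l : List ℕ+) (N : ℕ) :
    trunc N (harmonicRev k l) = hsum k N * hsum l N := by
  induction k, l using harmonicRev.induct generalizing N with
  | case1 l => rw [harmonicRev, trunc_z, hsum_nil, one_mul]
  | case2 a k => rw [harmonicRev, trunc_z, hsum_nil, mul_one]
  | case3 a k b l ih1 ih2 ih3 =>
    rw [harmonicRev, map_add, map_add]
    induction N with
    | zero => simp [trunc_zero_mul_zOne, hsum]
    | succ N ih =>
      have hsucc : ∀ c d e : ℝ, c + d + e = hsum (a :: k) N * hsum (b :: l) N →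
          c + hsum k N * hsum (b :: l) N / ((N : ℝ) + 1) ^ (a : ℕ)
            + (d + hsum (a :: k) N * hsum l N / ((N : ℝ) + 1) ^ (b : ℕ))
            + (e + hsum k N * hsum l N / ((N : ℝ) + 1) ^ ((a : ℕ) + b)) =
          hsum (a :: k) (N + 1) * hsum (b :: l) (N + 1) := fun c d e h => by
        rw [hsum_cons_succ, hsum_cons_succ, pow_add]
        linear_combination h
      rw [trunc_succ_mul_zOne, trunc_succ_mul_zOne, trunc_succ_mul_zOne, ih1, ih2, ih3,
        PNat.add_coe, hsucc _ _ _ ih]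

theorem trunc_harmonic (N : ℕ) (u v : H1) : trunc N (harmonic u v) = trunc N u * trunc N v :=
  map_prod_of_map_prod_z (fun r t => by
    rw [harmonic_z, List.reverse_reverse, List.reverse_reverse, trunc_harmonicRev, trunc_z,
      trunc_z]) u v

/-! ### Multiple polylogarithms as power series -/

section Euler

variable {K : Type*} [Field K]

/-- The Euler operator `t d/dt` on power series. -/
def euler : Derivation K K⟦X⟧ K⟦X⟧ := (PowerSeries.X : K⟦X⟧) • PowerSeries.derivative K

theorem coeff_euler (f : K⟦X⟧) (n : ℕ) :
    PowerSeries.coeff n (euler f) = n * PowerSeries.coeff n f := by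
  rw [euler, Derivation.smul_apply, smul_eq_mul]
  cases n with
  | zero => simp
  | succ n =>
    rw [PowerSeries.coeff_succ_X_mul, PowerSeries.coeff_derivative, mul_comm]
    push_cast
    rfl

theorem eq_of_euler_eq [CharZero K] {f g : K⟦X⟧} (h : euler f = euler g)
    (h0 : PowerSeries.constantCoeff f = PowerSeries.constantCoeff g) : f = g := by
  ext n
  cases n with
  | zero => simpa using h0
  | succ n =>
    refine mul_left_cancel₀ (Nat.cast_ne_zero.2 n.succ_ne_zero : ((n + 1 : ℕ) : K) ≠ 0) ?_
    rw [← coeff_euler, ← coeff_euler, h]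

/-- The right inverse of `t d/dt` on power series without constant term, i.e. integration from `0`
against `dt / t`. The constant term of the result is `0`, by the convention `c / 0 = 0`. -/
def eulerInv : K⟦X⟧ →ₗ[K] K⟦X⟧ where
  toFun f := PowerSeries.mk fun n => PowerSeries.coeff n f / n
  map_add' f g := by ext n; simp [add_div]
  map_smul' c f := by ext n; simp [mul_div_assoc]

theorem coeff_eulerInv (f : K⟦X⟧) (n : ℕ) :
    PowerSeries.coeff n (eulerInv f) = PowerSeries.coeff n f / n :=
  PowerSeries.coeff_mk n fun n => PowerSeries.coeff n f / n

theorem constantCoeff_eulerInv (f : K⟦X⟧) : PowerSeries.constantCoeff (eulerInv f) = 0 := by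
  rw [← PowerSeries.coeff_zero_eq_constantCoeff_apply, coeff_eulerInv, Nat.cast_zero, div_zero]

theorem euler_eulerInv [CharZero K] {f : K⟦X⟧} (h : PowerSeries.constantCoeff f = 0) :
    euler (eulerInv f) = f := by
  ext n
  rw [coeff_euler, coeff_eulerInv]
  cases n with
  | zero => simp [h]
  | succ n => exact mul_div_cancel₀ _ (Nat.cast_ne_zero.2 n.succ_ne_zero)

end Euler

/-- The differential form attached to a letter, relative to `dt / t`: that of `x` is `dt / t`,
and that of `y` is `dt / (1 - t)`. -/
def letterSeries : Letter → ℝ⟦X⟧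
  | Letter.x => 1
  | Letter.y => PowerSeries.X * PowerSeries.mk 1

/-- The power series at `0` of the multiple polylogarithm (iterated integral) of a word, given by
its reversal. -/
def polylogRev : List Letter → ℝ⟦X⟧
  | [] => 1
  | a :: u => eulerInv (letterSeries a * polylogRev u)

theorem constantCoeff_polylogRev_cons (a : Letter) (u : List Letter) :
    PowerSeries.constantCoeff (polylogRev (a :: u)) = 0 :=
  constantCoeff_eulerInv _

theorem euler_polylogRev_cons {a : Letter} {u : List Letter}
    (h : (a :: u).getLast? ≠ some Letter.x) :
    euler (polylogRev (a :: u)) = letterSeries a * polylogRev u := by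
  refine euler_eulerInv ?_
  cases a with
  | y => simp [letterSeries]
  | x =>
    cases u with
    | nil => simp at h
    | cons b u => rw [map_mul, constantCoeff_polylogRev_cons, mul_zero]

/-- The linear map on `𝔥` that sends a word to its multiple polylogarithm. -/
def polylog : H →ₗ[ℚ] ℝ⟦X⟧ :=
  (FreeAlgebra.basisFreeMonoid ℚ Letter).constr ℚ fun u => polylogRev u.toList.reverse

theorem polylog_mono (u : List Letter) : polylog (mono u.reverse) = polylogRev u := by
  have hu := basisFreeMonoid_apply (FreeMonoid.ofList u.reverse)
  rw [FreeMonoid.toList_ofList] at hu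
  rw [← hu, polylog, Module.Basis.constr_basis, FreeMonoid.toList_ofList, List.reverse_reverse]

theorem polylog_mul_letter (w : H) (a : Letter) :
    polylog (w * FreeAlgebra.ι ℚ a) = eulerInv (letterSeries a * polylog w) := by
  have h : polylog ∘ₗ LinearMap.mulRight ℚ (FreeAlgebra.ι ℚ a) =
      (eulerInv.restrictScalars ℚ) ∘ₗ LinearMap.mulLeft ℚ (letterSeries a) ∘ₗ polylog :=
    H_hom_ext fun u => by
      rw [LinearMap.comp_apply, LinearMap.mulRight_apply, ← mono_reverse_cons, polylog_mono,
        LinearMap.comp_apply, LinearMap.comp_apply, polylog_mono]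
      rfl
  exact LinearMap.congr_fun h w

theorem getLast?_ne_of_getLast?_cons_ne {α : Type*} {a x : α} {u : List α}
    (h : (a :: u).getLast? ≠ some x) : u.getLast? ≠ some x := by
  cases u with
  | nil => simp
  | cons b u => rwa [List.getLast?_cons_cons] at h

theorem polylog_shuffleRev (u v : List Letter) (hu : u.getLast? ≠ some Letter.x)
    (hv : v.getLast? ≠ some Letter.x) :
    polylog (shuffleRev u v) = polylogRev u * polylogRev v := by
  induction u, v using shuffleRev.induct with
  | case1 v => rw [shuffleRev, polylog_mono, polylogRev, one_mul]
  | case2 a u => rw [shuffleRev, polylog_mono, polylogRev, polylogRev, mul_one]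
  | case3 a u b v ih1 ih2 =>
    rw [shuffleRev, map_add, polylog_mul_letter, polylog_mul_letter,
      ih1 (getLast?_ne_of_getLast?_cons_ne hu) hv, ih2 hu (getLast?_ne_of_getLast?_cons_ne hv)]
    apply eq_of_euler_eq
    · have ha : euler (polylogRev (a :: u)) = letterSeries a * polylogRev u :=
        euler_polylogRev_cons hu
      have hb : euler (polylogRev (b :: v)) = letterSeries b * polylogRev v :=
        euler_polylogRev_cons hv
      rw [map_add, Derivation.leibniz, ha, hb, euler_eulerInv, euler_eulerInv]
      · simp only [smul_eq_mul]
        ring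
      · simp [constantCoeff_polylogRev_cons]
      · simp [constantCoeff_polylogRev_cons]
    · simp [constantCoeff_eulerInv, constantCoeff_polylogRev_cons]

theorem polylog_shuffleH1 (u v : H1) :
    polylog (shuffleH1 u v : H1) = polylog (u : H) * polylog (v : H) := by
  refine map_prod_of_map_prod_z (f := polylog ∘ₗ H1.val.toLinearMap) (μ := shuffleH1)
    (fun r t => ?_) u v
  have h : ((shuffleH1 (z r.reverse) (z t.reverse) : H1) : H) =
    shuffle (z r.reverse : H1) (z t.reverse : H1) := rfl
  simp only [LinearMap.comp_apply, AlgHom.toLinearMap_apply, Subalgebra.coe_val, h]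
  rw [coe_z, coe_z, shuffle_mono, polylog_shuffleRev _ _ (wordOf_head _) (wordOf_head _),
    ← polylog_mono, ← polylog_mono, List.reverse_reverse, List.reverse_reverse]

theorem coeff_zero_polylog_z_cons (a : ℕ+) (r : List ℕ+) :
    PowerSeries.coeff 0 (polylog (z (a :: r).reverse : H1)) = 0 := by
  obtain ⟨v, c, h⟩ : ∃ (v : H) (c : Letter),
      ((z (a :: r).reverse : H1) : H) = v * FreeAlgebra.ι ℚ c := by
    rw [z_reverse_cons, MulMemClass.coe_mul]
    by_cases ha : a = 1
    · exact ⟨_, Letter.y, by rw [ha, coe_zOne_one]⟩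
    · obtain ⟨v, hv⟩ := coe_zOne_of_ne_one ha
      exact ⟨_, Letter.x, by rw [hv, mul_assoc]⟩
  rw [h, polylog_mul_letter, PowerSeries.coeff_zero_eq_constantCoeff_apply, constantCoeff_eulerInv]

theorem coeff_succ_polylog_mul_y (w : H) (n : ℕ) :
    PowerSeries.coeff (n + 1) (polylog (w * Y)) =
      (∑ i ∈ Finset.range (n + 1), PowerSeries.coeff i (polylog w)) / ((n : ℝ) + 1) := by
  rw [Y, polylog_mul_letter, coeff_eulerInv, letterSeries, mul_assoc,
    PowerSeries.coeff_succ_X_mul, mul_comm, PowerSeries.coeff_mul,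
    Finset.Nat.sum_antidiagonal_eq_sum_range_succ_mk]
  simp

theorem coeff_succ_polylog_mul_zOne (w : H) (a : ℕ+) (n : ℕ) :
    PowerSeries.coeff (n + 1) (polylog (w * zOne a)) =
      (∑ i ∈ Finset.range (n + 1), PowerSeries.coeff i (polylog w)) / ((n : ℝ) + 1) ^ (a : ℕ) := by
  have hx : ∀ m : ℕ, PowerSeries.coeff (n + 1) (polylog (w * (Y * X ^ m))) =
      (∑ i ∈ Finset.range (n + 1), PowerSeries.coeff i (polylog w)) / ((n : ℝ) + 1) ^ (m + 1) := by
    intro m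
    induction m with
    | zero => rw [pow_zero, mul_one, coeff_succ_polylog_mul_y, zero_add, pow_one]
    | succ m ih =>
      have hX : w * (Y * X ^ (m + 1)) = w * (Y * X ^ m) * FreeAlgebra.ι ℚ Letter.x := by
        simp only [pow_succ, X, mul_assoc]
      rw [hX, polylog_mul_letter, coeff_eulerInv, letterSeries, one_mul, ih, div_div,
        Nat.cast_succ, ← pow_succ]
  have hz : (zOne a : H) = Y * X ^ ((a : ℕ) - 1) := rfl
  rw [hz, hx, Nat.sub_add_cancel a.pos]

theorem sum_coeff_polylog_z (r : List ℕ+) (n : ℕ) :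
    ∑ i ∈ Finset.range (n + 1), PowerSeries.coeff i (polylog (z r.reverse : H1)) = hsum r n := by
  induction r generalizing n with
  | nil =>
    have h : polylog (z ([] : List ℕ+).reverse : H1) = 1 := polylog_mono []
    rw [h, hsum_nil, Finset.sum_range_succ']
    simp [PowerSeries.coeff_one]
  | cons a r ih =>
    rw [hsum, Finset.sum_range_succ', coeff_zero_polylog_z_cons, add_zero]
    refine Finset.sum_congr rfl fun m _ => ?_
    rw [z_reverse_cons, MulMemClass.coe_mul, coeff_succ_polylog_mul_zOne, ih]

theorem coeff_succ_polylog_z (a : ℕ+) (r : List ℕ+) (n : ℕ) :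
    PowerSeries.coeff (n + 1) (polylog (z (a :: r).reverse : H1)) =
      hsum r n / ((n : ℝ) + 1) ^ (a : ℕ) := by
  rw [z_reverse_cons, MulMemClass.coe_mul, coeff_succ_polylog_mul_zOne, sum_coeff_polylog_z]

/-! ### Truncated sums and multiple zeta values -/

/-- The strictly increasing `r`-tuples of positive integers that are at most `N`: the indices of
the series of a multiple zeta value for `N = ⊤`, and of its truncation for finite `N`. -/
abbrev IncTuple (r : ℕ) (N : ℕ∞) : Type :=
  {n : Fin r → ℕ // ((∀ i, 0 < n i) ∧ StrictMono n) ∧ ∀ i, (n i : ℕ∞) ≤ N}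

namespace IncTuple

variable {r : ℕ} {N : ℕ∞}

instance instUniqueZero : Unique (IncTuple 0 N) where
  default := ⟨Fin.elim0, ⟨fun i => i.elim0, fun i => i.elim0⟩, fun i => i.elim0⟩
  uniq _ := Subtype.ext (Subsingleton.elim _ _)

/-- The tuple of all entries but the last, which bounds them. -/
def init (n : IncTuple (r + 1) N) : IncTuple r ↑(n.1 (Fin.last r) - 1) :=
  ⟨Fin.init n.1, ⟨fun _ => n.2.1.1 _, n.2.1.2.comp Fin.strictMono_castSucc⟩,
    fun i => Nat.cast_le.2 (Nat.le_sub_one_of_lt (n.2.1.2 (Fin.castSucc_lt_last i)))⟩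

/-- The tuple `n` followed by `m + 1`. -/
def snoc {m : ℕ} (hm : (m : ℕ∞) < N) (n : IncTuple r m) : IncTuple (r + 1) N := by
  have hn (i) : n.1 i < m + 1 := Nat.lt_succ_of_le (Nat.cast_le.1 (n.2.2 i))
  have hN : ((m + 1 : ℕ) : ℕ∞) ≤ N := by exact_mod_cast Order.add_one_le_of_lt hm
  refine ⟨Fin.snoc n.1 (m + 1), ⟨fun i => ?_, fun i j h => ?_⟩, fun i => ?_⟩
  · cases i using Fin.lastCases <;> simp [n.2.1.1]
  · cases i using Fin.lastCases with
    | last => exact absurd (Fin.le_last j) (not_le.2 h)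
    | cast i =>
      cases j using Fin.lastCases with
      | last => simpa using hn i
      | cast j => simpa using n.2.1.2 (Fin.castSucc_lt_castSucc_iff.1 h)
  · refine le_trans (Nat.cast_le.2 ?_) hN
    cases i using Fin.lastCases <;> simp [(hn _).le]

theorem last_sub_one_lt (n : IncTuple (r + 1) N) : ((n.1 (Fin.last r) - 1 : ℕ) : ℕ∞) < N :=
  (Nat.cast_lt.2 (Nat.sub_one_lt (n.2.1.1 _).ne')).trans_le (n.2.2 _)

theorem sigma_ext {p q : Σ m : {m : ℕ // (m : ℕ∞) < N}, IncTuple r m.1} (h : p.1.1 = q.1.1)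
    (h' : p.2.1 = q.2.1) : p = q := by
  obtain ⟨⟨m, hm⟩, n, hn⟩ := p
  obtain ⟨⟨m', hm'⟩, n', hn'⟩ := q
  subst h h'
  rfl

/-- A tuple is given by its last entry `m + 1` and by the tuple of its other entries. -/
def succEquiv : IncTuple (r + 1) N ≃ Σ m : {m : ℕ // (m : ℕ∞) < N}, IncTuple r m.1 where
  toFun n := ⟨⟨_, n.last_sub_one_lt⟩, n.init⟩
  invFun p := snoc p.1.2 p.2
  left_inv n := by
    have := Nat.sub_add_cancel (n.2.1.1 (Fin.last r))
    exact Subtype.ext (by simp [snoc, init, this])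
  right_inv p := sigma_ext (by simp [snoc]) (by simp [snoc, init])

theorem prod_one_div_snoc (e : Fin (r + 1) → ℕ+) {m : ℕ} (hm : (m : ℕ∞) < N) (n : IncTuple r m) :
    ∏ i, 1 / ((snoc hm n).1 i : ℝ) ^ (e i : ℕ) =
      (∏ i, 1 / (n.1 i : ℝ) ^ (Fin.init e i : ℕ)) * (1 / ((m : ℝ) + 1) ^ (e (Fin.last r) : ℕ)) := by
  simp [Fin.prod_univ_castSucc, snoc, Fin.init, mul_comm]

theorem hasSum_succ {e : Fin (r + 1) → ℕ+} {g : ℕ → ℝ} {S : ℝ}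
    (hg : ∀ m : ℕ, HasSum (fun n : IncTuple r m => ∏ i, 1 / (n.1 i : ℝ) ^ (Fin.init e i : ℕ)) (g m))
    (hS : HasSum (fun m : {m : ℕ // (m : ℕ∞) < N} =>
      g m / ((m : ℝ) + 1) ^ (e (Fin.last r) : ℕ)) S) :
    HasSum (fun n : IncTuple (r + 1) N => ∏ i, 1 / (n.1 i : ℝ) ^ (e i : ℕ)) S := by
  rw [← succEquiv.symm.hasSum_iff]
  have hfib (m : {m : ℕ // (m : ℕ∞) < N}) : HasSum (fun n : IncTuple r m.1 =>
      ∏ i, 1 / ((snoc m.2 n).1 i : ℝ) ^ (e i : ℕ))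
        (g m / ((m : ℝ) + 1) ^ (e (Fin.last r) : ℕ)) := by
    simp only [prod_one_div_snoc]
    simpa only [mul_one_div] using (hg m).mul_right (1 / ((m : ℝ) + 1) ^ (e (Fin.last r) : ℕ))
  refine hS.sigma_of_hasSum hfib ((summable_sigma_of_nonneg fun p => ?_).2
    ⟨fun m => (hfib m).summable, hS.summable.congr fun m => (hfib m).tsum_eq.symm⟩)
  exact Finset.prod_nonneg fun i _ => by positivity

end IncTuple

theorem reverse_ofFn_succ {α : Type*} {r : ℕ} (e : Fin (r + 1) → α) :
    (List.ofFn e).reverse = e (Fin.last r) :: (List.ofFn (Fin.init e)).reverse := by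
  rw [List.ofFn_succ', List.concat_eq_append, List.reverse_append]
  rfl

theorem hasSum_hsum {r : ℕ} (e : Fin r → ℕ+) (N : ℕ) :
    HasSum (fun n : IncTuple r N => ∏ i, 1 / (n.1 i : ℝ) ^ (e i : ℕ))
      (hsum (List.ofFn e).reverse N) := by
  induction r generalizing N with
  | zero =>
    convert hasSum_unique (fun n : IncTuple 0 N => ∏ i, 1 / (n.1 i : ℝ) ^ (e i : ℕ)) using 1
    simp [hsum]
  | succ r ih =>
    rw [reverse_ofFn_succ, hsum]
    refine IncTuple.hasSum_succ (fun m => ih (Fin.init e) m) ?_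
    exact ((Equiv.subtypeEquivRight fun m => by simp).hasSum_iff
      (f := fun m : {m // m ∈ Finset.range N} => hsum (List.ofFn (Fin.init e)).reverse m.1 /
        ((m.1 : ℝ) + 1) ^ (e (Fin.last r) : ℕ))).2 (Finset.hasSum _ _)

theorem mzv_eq_tsum_incTuple (k : Index) :
    mzv k = ∑' n : IncTuple k.length ⊤, ∏ i, 1 / (n.1 i : ℝ) ^ (k.get i : ℕ) := by
  let e : {n : Fin k.length → ℕ // (∀ i, 0 < n i) ∧ StrictMono n} ≃ IncTuple k.length ⊤ :=
    Equiv.subtypeEquivRight fun n => by simp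
  exact e.tsum_eq fun n : IncTuple k.length ⊤ => ∏ i, 1 / (n.1 i : ℝ) ^ (k.get i : ℕ)

theorem mzv_nil : mzv [] = 1 := by
  rw [mzv_eq_tsum_incTuple]
  exact (hasSum_unique (β := IncTuple 0 ⊤) _).tsum_eq

theorem mzv_eq_of_hasSum {a : ℕ+} {r : List ℕ+} {S : ℝ}
    (hS : HasSum (fun m : ℕ => hsum r m / ((m : ℝ) + 1) ^ (a : ℕ)) S) :
    mzv (a :: r).reverse = S := by
  suffices h : ∀ (l : ℕ) (e : Fin l → ℕ+), (List.ofFn e).reverse = a :: r →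
      HasSum (fun n : IncTuple l ⊤ => ∏ i, 1 / (n.1 i : ℝ) ^ (e i : ℕ)) S by
    rw [mzv_eq_tsum_incTuple]
    exact (h _ _ (by rw [List.ofFn_get, List.reverse_reverse])).tsum_eq
  intro l e he
  cases l with
  | zero => simp at he
  | succ l =>
    obtain ⟨rfl, rfl⟩ := List.cons.inj ((reverse_ofFn_succ e).symm.trans he)
    refine IncTuple.hasSum_succ (hasSum_hsum (Fin.init e)) ?_
    exact ((Equiv.subtypeUnivEquiv fun m => by simp).hasSum_iff).2 hS

/-! ### Growth of the truncated sums -/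

theorem hsum_one (N : ℕ) : hsum [1] N = (_root_.harmonic N : ℚ) := by
  simp [hsum, _root_.harmonic]

theorem hsum_monotone (r : List ℕ+) : Monotone (hsum r) := by
  cases r with
  | nil => exact monotone_const
  | cons a r =>
    refine monotone_nat_of_le_succ fun n => ?_
    rw [hsum_cons_succ]
    exact le_add_of_nonneg_right (div_nonneg (hsum_nonneg r n) (by positivity))

theorem hsum_le_pow (r : List ℕ+) (N : ℕ) : hsum r N ≤ hsum [1] N ^ r.length := by
  induction r with
  | nil => simp [hsum]
  | cons a r ih =>
    calc hsum (a :: r) N ≤ ∑ m ∈ Finset.range N, hsum r N * (1 / ((m : ℝ) + 1)) :=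
          Finset.sum_le_sum fun m hm => by
            rw [mul_one_div]
            exact div_le_div₀ (hsum_nonneg _ _) (hsum_monotone r (Finset.mem_range.1 hm).le)
              (by positivity) (le_self_pow₀ (by linarith [m.cast_nonneg (α := ℝ)]) a.pos.ne')
      _ = hsum r N * hsum [1] N := by simp [hsum, Finset.mul_sum]
      _ ≤ hsum [1] N ^ (a :: r).length :=
          mul_le_mul_of_nonneg_right ih (hsum_nonneg _ _)

theorem hsum_one_isBigO_log : hsum [1] =O[atTop] fun N : ℕ => Real.log N := by
  have h : (fun N : ℕ => 1 + Real.log N) =O[atTop] fun N : ℕ => Real.log N :=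
    (Real.isLittleO_const_log_atTop.comp_tendsto tendsto_natCast_atTop_atTop).isBigO.add
      (Asymptotics.isBigO_refl _ _)
  refine .trans (.of_norm_le fun N => ?_) h
  rw [Real.norm_of_nonneg (hsum_nonneg _ _), hsum_one]
  exact harmonic_le_one_add_log N

theorem hsum_one_pow_isLittleO (d : ℕ) {ε : ℝ} (hε : 0 < ε) :
    (fun N => hsum [1] N ^ d) =o[atTop] fun N : ℕ => ((N : ℝ) + 1) ^ ε := by
  have h : (fun N : ℕ => Real.log N ^ d) =o[atTop] fun N : ℕ => (N : ℝ) ^ ε := by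
    simpa [Function.comp_def] using
      (isLittleO_log_rpow_rpow_atTop d hε).comp_tendsto tendsto_natCast_atTop_atTop
  refine ((hsum_one_isBigO_log.pow d).trans_isLittleO h).trans_isBigO (.of_norm_le fun N => ?_)
  rw [Real.norm_of_nonneg (by positivity)]
  exact Real.rpow_le_rpow (by positivity) (by linarith) hε.le

theorem hsum_isLittleO (r : List ℕ+) {ε : ℝ} (hε : 0 < ε) :
    hsum r =o[atTop] fun N : ℕ => ((N : ℝ) + 1) ^ ε := by
  refine (Asymptotics.IsBigO.of_norm_le fun N => ?_).trans_isLittleO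
    (hsum_one_pow_isLittleO r.length hε)
  rw [Real.norm_of_nonneg (hsum_nonneg _ _)]
  exact hsum_le_pow r N

theorem summable_hsum_div_mul_sqrt {a : ℕ+} (ha : a ≠ 1) (r : List ℕ+) :
    Summable fun m : ℕ => hsum r m / ((m : ℝ) + 1) ^ (a : ℕ) * √((m : ℝ) + 1) := by
  have hs : Summable fun m : ℕ => ((m : ℝ) + 1) ^ (-(5 / 4) : ℝ) := by
    simpa using (summable_nat_add_iff 1).2
      (Real.summable_nat_rpow.2 (by norm_num : -(5 / 4 : ℝ) < -1))
  refine summable_of_isBigO_nat hs (.trans (.of_norm_le fun m => ?_)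
    (((hsum_isLittleO r (by norm_num : (0 : ℝ) < 1 / 4)).isBigO.mul
      (Asymptotics.isBigO_refl (fun m : ℕ => ((m : ℝ) + 1) ^ (-(3 / 2) : ℝ)) _)).congr_right
      fun m => ?_))
  · have ha2 : 2 ≤ (a : ℕ) := bot_lt_iff_ne_bot.2 ha
    have hm : (1 : ℝ) ≤ (m : ℝ) + 1 := by linarith [m.cast_nonneg (α := ℝ)]
    have hsum0 := hsum_nonneg r m
    rw [Real.norm_of_nonneg (by positivity)]
    calc hsum r m / ((m : ℝ) + 1) ^ (a : ℕ) * √((m : ℝ) + 1)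
        ≤ hsum r m / ((m : ℝ) + 1) ^ 2 * √((m : ℝ) + 1) := by gcongr
      _ = hsum r m * ((m : ℝ) + 1) ^ (-(3 / 2) : ℝ) := by
          rw [Real.sqrt_eq_rpow, ← Real.rpow_natCast, div_eq_mul_inv,
            ← Real.rpow_neg (by positivity), mul_assoc, ← Real.rpow_add (by positivity)]
          norm_num
  · rw [← Real.rpow_add (by positivity)]
    norm_num

theorem hasSum_mzv {a : ℕ+} (ha : a ≠ 1) (r : List ℕ+) :
    HasSum (fun m : ℕ => hsum r m / ((m : ℝ) + 1) ^ (a : ℕ)) (mzv (a :: r).reverse) := by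
  have h0 (m : ℕ) : 0 ≤ hsum r m / ((m : ℝ) + 1) ^ (a : ℕ) :=
    div_nonneg (hsum_nonneg _ _) (by positivity)
  have hs : Summable fun m : ℕ => hsum r m / ((m : ℝ) + 1) ^ (a : ℕ) :=
    .of_nonneg_of_le h0 (fun m => le_mul_of_one_le_right (h0 m)
      (Real.one_le_sqrt.2 (by linarith [m.cast_nonneg (α := ℝ)])))
      (summable_hsum_div_mul_sqrt ha r)
  rw [mzv_eq_of_hasSum hs.hasSum]
  exact hs.hasSum

theorem abs_sub_le_of_hasSum_mul {c b w : ℕ → ℝ} {S T B δ : ℝ} (hc : ∀ m, 0 ≤ c m)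
    (hB : HasSum (fun m => c m * b m) B) (hS : HasSum c S) (hT : HasSum (fun m => c m * w m) T)
    (hw : ∀ m, w m ≤ 1) (hwb : ∀ m, 1 - w m ≤ b m / δ) : |T - S| ≤ B / δ := by
  have h := hS.sub hT
  have h0 : 0 ≤ S - T := h.nonneg fun m => sub_nonneg.2 (mul_le_of_le_one_right (hc m) (hw m))
  rw [abs_sub_comm, abs_of_nonneg h0]
  refine hasSum_le (fun m => ?_) h (hB.div_const _)
  calc c m - c m * w m = c m * (1 - w m) := by ring
    _ ≤ c m * (b m / δ) := mul_le_mul_of_nonneg_left (hwb m) (hc m)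
    _ = c m * b m / δ := by ring

/-! ### Regularization by asymptotic expansion -/

section HasExpansion

variable {A : Type*} [CommRing A] [Algebra A ℝ] {ℓ f g : ℕ → ℝ} {P Q : A[X]}

/-- The polynomial `P` in `ℓ` is an asymptotic expansion of `f`. The error decays faster than every
power of `ℓ` grows, so that expansions can be multiplied. -/
def HasExpansion (ℓ f : ℕ → ℝ) (P : A[X]) : Prop :=
  Asymptotics.SuperpolynomialDecay atTop ℓ fun N => f N - Polynomial.aeval (ℓ N) P

namespace HasExpansion

theorem tendsto (h : HasExpansion ℓ f P) :
    Tendsto (fun N => f N - Polynomial.aeval (ℓ N) P) atTop (𝓝 0) := by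
  simpa using h 0

theorem add (hf : HasExpansion ℓ f P) (hg : HasExpansion ℓ g Q) :
    HasExpansion ℓ (f + g) (P + Q) :=
  (Asymptotics.SuperpolynomialDecay.add hf hg).congr fun N => by
    simp only [Pi.add_apply, map_add]
    ring

theorem mul (hf : HasExpansion ℓ f P) (hg : HasExpansion ℓ g Q) :
    HasExpansion ℓ (f * g) (P * Q) := by
  have h := (Asymptotics.SuperpolynomialDecay.mul hf hg).add
    ((hf.mul_polynomial (Q.map (algebraMap A ℝ))).add (hg.mul_polynomial (P.map (algebraMap A ℝ))))
  refine h.congr fun N => ?_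
  simp only [Pi.add_apply, Pi.mul_apply, map_mul, Polynomial.eval_map_algebraMap]
  ring

theorem of_aeval (h : ∀ N, f N = Polynomial.aeval (ℓ N) P) : HasExpansion ℓ f P :=
  (Asymptotics.superpolynomialDecay_zero _ _).congr fun N => (sub_eq_zero.2 (h N)).symm

end HasExpansion

theorem eq_zero_of_tendsto_eval {P : ℝ[X]} (hℓ : Tendsto ℓ atTop atTop)
    (h : Tendsto (fun N => P.eval (ℓ N)) atTop (𝓝 0)) : P = 0 := by
  have hdeg : P.degree ≤ 0 := not_lt.1 fun hlt =>
    not_tendsto_nhds_of_tendsto_atTop ((P.abs_tendsto_atTop hlt).comp hℓ) _ h.abs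
  rw [Polynomial.eq_C_of_degree_le_zero hdeg] at h ⊢
  simp only [Polynomial.eval_C] at h
  rw [tendsto_nhds_unique tendsto_const_nhds h, Polynomial.C_0]

theorem eq_of_tendsto_sub_aeval [FaithfulSMul A ℝ] (hℓ : Tendsto ℓ atTop atTop)
    (hP : Tendsto (fun N => f N - Polynomial.aeval (ℓ N) P) atTop (𝓝 0))
    (hQ : Tendsto (fun N => f N - Polynomial.aeval (ℓ N) Q) atTop (𝓝 0)) : P = Q := by
  refine Polynomial.map_injective _ (FaithfulSMul.algebraMap_injective A ℝ) (sub_eq_zero.1 ?_)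
  refine eq_zero_of_tendsto_eval hℓ ?_
  simpa [Polynomial.eval_map_algebraMap] using hQ.sub hP

theorem HasExpansion.unique [FaithfulSMul A ℝ] (hℓ : Tendsto ℓ atTop atTop)
    (hP : HasExpansion ℓ f P) (hQ : HasExpansion ℓ f Q) : P = Q :=
  eq_of_tendsto_sub_aeval hℓ hP.tendsto hQ.tendsto

end HasExpansion

/-- A realization of the product `•` by real-valued homomorphisms `Φ N` that diverge at `y`, and
whose values at admissible monomials converge rapidly to multiple zeta values. -/
structure IsModel (s : Kind) (Φ : ℕ → H1 →ₗ[ℚ] ℝ) (ℓ : ℕ → ℝ) : Prop where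
  tendsto : Tendsto ℓ atTop atTop
  map_one : ∀ N, Φ N 1 = 1
  map_prod : ∀ N u v, Φ N (s.prod u v) = Φ N u * Φ N v
  map_y : ∀ N, Φ N (z [1]) = ℓ N
  map_admissible : ∀ k, Admissible k →
    Asymptotics.SuperpolynomialDecay atTop ℓ fun N => Φ N (z k) - mzv k

namespace IsModel

variable {s : Kind} {Φ : ℕ → H1 →ₗ[ℚ] ℝ} {ℓ : ℕ → ℝ} {u v : H1} {P Q : mzvAlg[X]}

theorem hasExpansion_add (hu : HasExpansion ℓ (Φ · u) P) (hv : HasExpansion ℓ (Φ · v) Q) :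
    HasExpansion ℓ (Φ · (u + v)) (P + Q) := by
  simpa only [map_add] using! hu.add hv

theorem hasExpansion_smul (c : ℚ) (hu : HasExpansion ℓ (Φ · u) P) :
    HasExpansion ℓ (Φ · (c • u)) (c • P) :=
  (hu.const_mul (c : ℝ)).congr fun N => by
    beta_reduce
    rw [(Φ N).map_smul, map_rat_smul (Polynomial.aeval (R := mzvAlg) (ℓ N)) c P, Rat.smul_def,
      Rat.smul_def, mul_sub]

theorem hasExpansion_prod (h : IsModel s Φ ℓ) (hu : HasExpansion ℓ (Φ · u) P)
    (hv : HasExpansion ℓ (Φ · v) Q) : HasExpansion ℓ (Φ · (s.prod u v)) (P * Q) := by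
  simpa only [h.map_prod] using! hu.mul hv

theorem hasExpansion_one (h : IsModel s Φ ℓ) : HasExpansion ℓ (Φ · 1) (1 : mzvAlg[X]) :=
  .of_aeval fun N => by rw [h.map_one, _root_.map_one]

theorem hasExpansion_y (h : IsModel s Φ ℓ) :
    HasExpansion ℓ (Φ · (z [1])) (Polynomial.X : mzvAlg[X]) :=
  .of_aeval fun N => by rw [h.map_y, Polynomial.aeval_X]

theorem hasExpansion_admissible (h : IsModel s Φ ℓ) (k : Index) (hk : Admissible k) :
    HasExpansion ℓ (Φ · (z k)) (Polynomial.C (mzvZ k hk)) :=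
  (h.map_admissible k hk).congr fun N => by
    rw [Polynomial.aeval_C]
    rfl

theorem exists_hasExpansion (h : IsModel s Φ ℓ) (w : H1) :
    ∃ P : mzvAlg[X], HasExpansion ℓ (Φ · w) P := by
  let V : Submodule ℚ H1 :=
    { carrier := {w | ∃ P : mzvAlg[X], HasExpansion ℓ (Φ · w) P}
      add_mem' := fun ⟨P, hP⟩ ⟨Q, hQ⟩ => ⟨P + Q, hasExpansion_add hP hQ⟩
      zero_mem' := ⟨0, .of_aeval fun N => by simp⟩
      smul_mem' := fun c _ ⟨P, hP⟩ => ⟨c • P, hasExpansion_smul c hP⟩ }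
  have hV : V = ⊤ := eq_top_of_admissible_of_prod_y s
    (fun k hk => ⟨_, h.hasExpansion_admissible k hk⟩)
    fun w ⟨P, hP⟩ => ⟨P * Polynomial.X, h.hasExpansion_prod hP h.hasExpansion_y⟩
  exact hV.ge (Submodule.mem_top : w ∈ ⊤)

theorem exists_isRegularization (h : IsModel s Φ ℓ) :
    ∃ Z, IsRegularization s Z ∧ ∀ w, HasExpansion ℓ (Φ · w) (Z w) := by
  choose Z hZ using h.exists_hasExpansion
  have key {w P} (hP : HasExpansion ℓ (Φ · w) P) : Z w = P := (hZ w).unique h.tendsto hP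
  exact ⟨{ toFun := Z
           map_add' := fun u v => key (hasExpansion_add (hZ u) (hZ v))
           map_smul' := fun c u => key (hasExpansion_smul c (hZ u)) },
    { map_one := key h.hasExpansion_one
      map_prod := fun u v => key (h.hasExpansion_prod (hZ u) (hZ v))
      map_admissible := fun k hk => key (h.hasExpansion_admissible k hk)
      map_y := key h.hasExpansion_y }, hZ⟩

end IsModel

theorem IsRegularization.unique {s : Kind} {Z Z' : H1 →ₗ[ℚ] mzvAlg[X]}
    (h : IsRegularization s Z) (h' : IsRegularization s Z') : Z = Z' := by
  refine LinearMap.eqLocus_eq_top.1 (eq_top_of_admissible_of_prod_y s (fun k hk => ?_)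
    fun u hu => ?_)
  · rw [LinearMap.mem_eqLocus, h.map_admissible k hk, h'.map_admissible k hk]
  · rw [LinearMap.mem_eqLocus] at hu ⊢
    rw [h.map_prod, h'.map_prod, h.map_y, h'.map_y, hu]

theorem del_of_admissible {k : Index} (hk : Admissible k) : del (z k) = 0 := by
  rw [← k.reverse_reverse] at hk ⊢
  generalize k.reverse = r at hk
  cases r with
  | nil => exact del_one
  | cons a r => rw [z_reverse_cons, del_mul_zOne, if_neg ((admissible_reverse_cons a r).1 hk)]

theorem IsRegularization.derivative {s : Kind} {Z : H1 →ₗ[ℚ] mzvAlg[X]}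
    (h : IsRegularization s Z) (w : H1) : Polynomial.derivative (Z w) = Z (del w) := by
  have key : Polynomial.derivative.restrictScalars ℚ ∘ₗ Z = Z ∘ₗ del := by
    refine LinearMap.eqLocus_eq_top.1 (eq_top_of_admissible_of_prod_y s (fun k hk => ?_)
      fun u hu => ?_)
    · simp [h.map_admissible k hk, del_of_admissible hk]
    · have hu : Polynomial.derivative (Z u) = Z (del u) := hu
      change Polynomial.derivative (Z _) = Z (del _)
      rw [del_prod_y, map_add, h.map_prod, h.map_prod, h.map_y, Polynomial.derivative_mul, hu,
        Polynomial.derivative_X, mul_one]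
  exact LinearMap.congr_fun key w

/-! ### The two models -/

theorem log_succ_le_hsum_one (N : ℕ) : Real.log ((N : ℝ) + 1) ≤ hsum [1] N := by
  rw [hsum_one]
  exact_mod_cast log_add_one_le_harmonic N

theorem tendsto_log_succ : Tendsto (fun N : ℕ => Real.log ((N : ℝ) + 1)) atTop atTop :=
  Real.tendsto_log_atTop.comp
    (tendsto_atTop_add_const_right _ (1 : ℝ) tendsto_natCast_atTop_atTop)

theorem superpolynomialDecay_of_abs_le {ℓ f : ℕ → ℝ} (hℓ0 : ∀ N, 0 ≤ ℓ N)
    (hℓ : ∀ N, ℓ N ≤ hsum [1] N) {C : ℝ} (hf : ∀ N : ℕ, |f N| ≤ C / √((N : ℝ) + 1)) :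
    Asymptotics.SuperpolynomialDecay atTop ℓ f := fun d => by
  have h := (hsum_one_pow_isLittleO d (by norm_num : (0 : ℝ) < 1 / 2)).tendsto_div_nhds_zero
  refine squeeze_zero_norm (fun N => ?_) (by simpa only [mul_zero] using h.const_mul C)
  rw [Real.norm_eq_abs, abs_mul, abs_of_nonneg (pow_nonneg (hℓ0 N) d), ← Real.sqrt_eq_rpow]
  calc ℓ N ^ d * |f N| ≤ hsum [1] N ^ d * (C / √((N : ℝ) + 1)) :=
        mul_le_mul (pow_le_pow_left₀ (hℓ0 N) (hℓ N) d) (hf N) (abs_nonneg _)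
          (pow_nonneg (hsum_nonneg _ _) d)
    _ = C * (hsum [1] N ^ d / √((N : ℝ) + 1)) := by ring

theorem superpolynomialDecay_sub_mzv {Φ : ℕ → H1 →ₗ[ℚ] ℝ} {ℓ : ℕ → ℝ} {w : ℕ → ℕ → ℝ}
    (hℓ0 : ∀ N, 0 ≤ ℓ N) (hℓ : ∀ N, ℓ N ≤ hsum [1] N) (h1 : ∀ N, Φ N 1 = 1)
    (hΦ : ∀ N (a : ℕ+) (r : List ℕ+),
      HasSum (fun m : ℕ => hsum r m / ((m : ℝ) + 1) ^ (a : ℕ) * w N m) (Φ N (z (a :: r).reverse)))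
    (hw : ∀ N m, w N m ≤ 1) (hwN : ∀ N m : ℕ, 1 - w N m ≤ √((m : ℝ) + 1) / √((N : ℝ) + 1))
    (k : Index) (hk : Admissible k) :
    Asymptotics.SuperpolynomialDecay atTop ℓ fun N => Φ N (z k) - mzv k := by
  rw [← k.reverse_reverse] at hk ⊢
  generalize k.reverse = r at hk
  cases r with
  | nil =>
    refine (Asymptotics.superpolynomialDecay_zero _ _).congr fun N => ?_
    rw [List.reverse_nil, z_nil, h1, mzv_nil, sub_self]
    rfl
  | cons a r =>
    have ha := (admissible_reverse_cons a r).1 hk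
    exact superpolynomialDecay_of_abs_le hℓ0 hℓ fun N =>
      abs_sub_le_of_hasSum_mul (fun m => div_nonneg (hsum_nonneg r m) (by positivity))
        (summable_hsum_div_mul_sqrt ha r).hasSum (hasSum_mzv ha r) (hΦ N a r) (hw N) (hwN N)

theorem isModel_trunc : IsModel .harmonic trunc (hsum [1]) where
  tendsto := tendsto_atTop_mono log_succ_le_hsum_one tendsto_log_succ
  map_one N := trunc_z N []
  map_prod := trunc_harmonic
  map_y N := trunc_z N [1]
  map_admissible := by
    refine superpolynomialDecay_sub_mzv (w := fun N m => if m < N then 1 else 0)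
      (hsum_nonneg _) (fun N => le_rfl) (fun N => trunc_z N []) (fun N a r => ?_)
      (fun N m => ?_) (fun N m => ?_)
    · rw [trunc_z, hsum]
      simp only [mul_ite, mul_one, mul_zero, ← Finset.mem_range]
      rw [← Finset.sum_congr rfl fun m hm => if_pos hm]
      exact hasSum_sum_of_ne_finset_zero fun m hm => if_neg hm
    · split_ifs <;> norm_num
    · split_ifs with h
      · rw [sub_self]
        positivity
      · rw [sub_zero, one_le_div (by positivity)]
        exact Real.sqrt_le_sqrt (by exact_mod_cast Nat.succ_le_succ (not_lt.1 h))

/-- The points `1 - 1 / (N + 1)`, which tend to `1` and at which the polylogarithm of `y` takes the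
value `log (N + 1)`. -/
def point (N : ℕ) : ℝ := 1 - 1 / ((N : ℝ) + 1)

theorem point_nonneg (N : ℕ) : 0 ≤ point N :=
  sub_nonneg.2 ((div_le_one (by positivity)).2 (by linarith [N.cast_nonneg (α := ℝ)]))

theorem point_lt_one (N : ℕ) : point N < 1 :=
  sub_lt_self 1 (by positivity)

theorem summable_polylog_z (r : List ℕ+) {x : ℝ} (hx : |x| < 1) :
    Summable fun n => PowerSeries.coeff n (polylog (z r.reverse : H1)) * x ^ n := by
  cases r with
  | nil =>
    have h : polylog (z ([] : List ℕ+).reverse : H1) = 1 := polylog_mono []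
    refine summable_of_ne_finset_zero (s := {0}) fun n hn => ?_
    rw [h, PowerSeries.coeff_one, if_neg (Finset.notMem_singleton.1 hn), zero_mul]
  | cons a r =>
    have hle (n : ℕ) : ‖hsum r n / ((n : ℝ) + 1) ^ (a : ℕ)‖ ≤ ‖hsum r n‖ := by
      rw [norm_div]
      refine div_le_self (norm_nonneg _) ?_
      rw [Real.norm_of_nonneg (by positivity)]
      exact one_le_pow₀ (by linarith [n.cast_nonneg (α := ℝ)])
    have hO : (fun n : ℕ => hsum r n / ((n : ℝ) + 1) ^ (a : ℕ)) =O[atTop]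
        fun n : ℕ => ((n : ℝ) + 1) ^ (1 : ℝ) :=
      (Asymptotics.isBigO_of_le _ hle).trans (hsum_isLittleO r one_pos).isBigO
    have hg : Summable fun n : ℕ => ((n : ℝ) + 1) ^ (1 : ℝ) * x ^ (n + 1) := by
      have h : Summable fun n : ℕ => (n : ℝ) ^ 1 * x ^ n :=
        summable_pow_mul_geometric_of_norm_lt_one 1 hx
      simpa using (summable_nat_add_iff 1).2 h
    rw [← summable_nat_add_iff 1]
    simp only [coeff_succ_polylog_z]
    exact summable_of_isBigO_nat hg (hO.mul (Asymptotics.isBigO_refl _ _))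

theorem summable_polylog (w : H1) {x : ℝ} (hx : |x| < 1) :
    Summable fun n => PowerSeries.coeff n (polylog w) * x ^ n := by
  let V : Submodule ℚ H1 :=
    { carrier := {w | Summable fun n => PowerSeries.coeff n (polylog w) * x ^ n}
      add_mem' := fun hu hv => by simpa [add_mul] using Summable.add hu hv
      zero_mem' := by simp [summable_zero]
      smul_mem' := fun c u hu => by
        simpa [Rat.smul_def, mul_assoc] using Summable.mul_left (c : ℝ) hu }
  have hV : V = ⊤ := eq_top_of_z_mem fun r => summable_polylog_z r hx
  exact hV.ge (Submodule.mem_top : w ∈ ⊤)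

theorem abs_point_lt_one (N : ℕ) : |point N| < 1 := by
  rw [abs_of_nonneg (point_nonneg N)]
  exact point_lt_one N

/-- Evaluation of multiple polylogarithms at `point N`. -/
def polylogAt (N : ℕ) : H1 →ₗ[ℚ] ℝ where
  toFun w := ∑' n, PowerSeries.coeff n (polylog w) * point N ^ n
  map_add' u v := by
    rw [← (summable_polylog u (abs_point_lt_one N)).tsum_add
      (summable_polylog v (abs_point_lt_one N))]
    simp [add_mul]
  map_smul' c u := by
    rw [RingHom.id_apply, Rat.smul_def, ← tsum_mul_left]
    simp [Rat.smul_def, mul_assoc]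

theorem hasSum_polylogAt (N : ℕ) (w : H1) :
    HasSum (fun n => PowerSeries.coeff n (polylog w) * point N ^ n) (polylogAt N w) :=
  (summable_polylog w (abs_point_lt_one N)).hasSum

theorem hasSum_polylogAt_z (N : ℕ) (a : ℕ+) (r : List ℕ+) :
    HasSum (fun m : ℕ => hsum r m / ((m : ℝ) + 1) ^ (a : ℕ) * point N ^ (m + 1))
      (polylogAt N (z (a :: r).reverse)) := by
  have h := (hasSum_nat_add_iff' 1).2 (hasSum_polylogAt N (z (a :: r).reverse))
  rw [Finset.sum_range_one, coeff_zero_polylog_z_cons, zero_mul, sub_zero] at h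
  simpa only [coeff_succ_polylog_z] using h

theorem polylogAt_shuffle (N : ℕ) (u v : H1) :
    polylogAt N (shuffleH1 u v) = polylogAt N u * polylogAt N v := by
  refine Eq.symm ((tsum_mul_tsum_eq_tsum_sum_antidiagonal_of_summable_norm
    (summable_polylog u (abs_point_lt_one N)).norm
    (summable_polylog v (abs_point_lt_one N)).norm).trans (tsum_congr fun n => ?_))
  rw [polylog_shuffleH1, PowerSeries.coeff_mul, Finset.sum_mul]
  refine Finset.sum_congr rfl fun p hp => ?_
  rw [← Finset.HasAntidiagonal.mem_antidiagonal.1 hp, pow_add]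
  ring

theorem polylogAt_one (N : ℕ) : polylogAt N 1 = 1 := by
  have h1 : polylog ((1 : H1) : H) = 1 := polylog_mono []
  have h := hasSum_polylogAt N 1
  rw [h1] at h
  simpa using h.unique (hasSum_single 0 fun n hn => by
    rw [PowerSeries.coeff_one, if_neg hn, zero_mul])

theorem polylogAt_y (N : ℕ) : polylogAt N (z [1]) = Real.log ((N : ℝ) + 1) := by
  have h := Real.hasSum_pow_div_log_of_abs_lt_one (abs_point_lt_one N)
  rw [point, sub_sub_cancel, one_div, Real.log_inv, neg_neg, ← one_div] at h
  refine (hasSum_polylogAt_z N 1 []).unique (h.congr_fun fun m => ?_)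
  rw [hsum_nil, PNat.one_coe, pow_one, point]
  ring

theorem one_sub_point_pow_le (N m : ℕ) :
    1 - point N ^ (m + 1) ≤ √((m : ℝ) + 1) / √((N : ℝ) + 1) := by
  set x := point N ^ (m + 1)
  have hx0 : 0 ≤ x := pow_nonneg (point_nonneg N) _
  have hx1 : x ≤ 1 := pow_le_one₀ (point_nonneg N) (point_lt_one N).le
  have bernoulli : 1 - x ≤ ((m : ℝ) + 1) / ((N : ℝ) + 1) := by
    have h := one_add_mul_sub_le_pow (by linarith [point_nonneg N] : -1 ≤ point N) (m + 1)
    rw [point, Nat.cast_succ] at h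
    calc 1 - x ≤ 1 - (1 + ((m : ℝ) + 1) * (1 - 1 / ((N : ℝ) + 1) - 1)) := sub_le_sub_left h 1
      _ = ((m : ℝ) + 1) / ((N : ℝ) + 1) := by ring
  rw [← Real.sqrt_div (by positivity)]
  refine Real.le_sqrt_of_sq_le (le_trans ?_ bernoulli)
  exact pow_le_of_le_one (sub_nonneg.2 hx1) (sub_le_self 1 hx0) two_ne_zero

theorem isModel_polylogAt : IsModel .shuffle polylogAt fun N => Real.log ((N : ℝ) + 1) where
  tendsto := tendsto_log_succ
  map_one := polylogAt_one
  map_prod := polylogAt_shuffle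
  map_y := polylogAt_y
  map_admissible := superpolynomialDecay_sub_mzv
    (fun N => Real.log_nonneg (by linarith [N.cast_nonneg (α := ℝ)])) log_succ_le_hsum_one
    polylogAt_one hasSum_polylogAt_z
    (fun N m => pow_le_one₀ (point_nonneg N) (point_lt_one N).le) one_sub_point_pow_le

/-! ### Comparison of the two regularizations -/

theorem exists_isRegularization : ∀ s : Kind, ∃ Z, IsRegularization s Z
  | .harmonic => isModel_trunc.exists_isRegularization.imp fun _ h => h.1
  | .shuffle => isModel_polylogAt.exists_isRegularization.imp fun _ h => h.1

theorem isRegularization_regHom (s : Kind) : IsRegularization s (regHom s) :=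
  Classical.epsilon_spec (exists_isRegularization s)

section Transfer

variable {ι : Type*} {s : Finset ι} {u : ι → H1}

theorem IsModel.tendsto_sum_sub {k : Kind} {Φ : ℕ → H1 →ₗ[ℚ] ℝ} {ℓ : ℕ → ℝ} (h : IsModel k Φ ℓ)
    (c : ι → mzvAlg) :
    Tendsto (fun N => ∑ i ∈ s, (c i : ℝ) * Φ N (u i) -
      Polynomial.aeval (ℓ N) (∑ i ∈ s, c i • regHom k (u i))) atTop (𝓝 0) := by
  obtain ⟨Z, hZ, hΦ⟩ := h.exists_isRegularization
  have hlim := tendsto_finsetSum s fun i _ => (hΦ (u i)).tendsto.const_mul (c i : ℝ)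
  simp only [mul_zero, Finset.sum_const_zero] at hlim
  refine hlim.congr fun N => ?_
  simp only [(isRegularization_regHom k).unique hZ, map_sum, map_smul, mul_sub,
    Finset.sum_sub_distrib]
  rfl

theorem sum_coeff_polylog (n : ℕ) (w : H1) :
    ∑ i ∈ Finset.range (n + 1), PowerSeries.coeff i (polylog w) = trunc n w := by
  have h : (∑ i ∈ Finset.range (n + 1), (PowerSeries.coeff (R := ℝ) i).restrictScalars ℚ) ∘ₗ
      polylog ∘ₗ H1.val.toLinearMap = trunc n := H1_hom_ext fun r => by
    rw [trunc_z, ← sum_coeff_polylog_z]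
    simp
  simpa using LinearMap.congr_fun h w

theorem tendsto_point : Tendsto point atTop (𝓝[<] 1) := by
  refine tendsto_nhdsWithin_iff.2 ⟨?_, .of_forall point_lt_one⟩
  simpa only [point, sub_zero] using! (tendsto_one_div_add_atTop_nhds_zero_nat (𝕜 := ℝ)).const_sub 1

/-- Abel's limit theorem: the truncated sums are the partial sums of the coefficients of the
polylogarithms. -/
theorem tendsto_sum_polylogAt {c : ι → ℝ}
    (h : Tendsto (fun N => ∑ i ∈ s, c i * trunc N (u i)) atTop (𝓝 0)) :
    Tendsto (fun N => ∑ i ∈ s, c i * polylogAt N (u i)) atTop (𝓝 0) := by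
  have hpartial : Tendsto (fun n => ∑ m ∈ Finset.range n,
      ∑ i ∈ s, c i * PowerSeries.coeff m (polylog (u i))) atTop (𝓝 0) := by
    refine (tendsto_add_atTop_iff_nat 1).1 (h.congr fun N => ?_)
    simp only [← sum_coeff_polylog, Finset.mul_sum]
    exact Finset.sum_comm
  refine ((Real.tendsto_tsum_powerSeries_nhdsWithin_lt hpartial).comp tendsto_point).congr
    fun N => ?_
  have hN := hasSum_sum fun i (_ : i ∈ s) => (hasSum_polylogAt N (u i)).mul_left (c i)
  exact (hN.congr_fun fun n => by simp only [Finset.sum_mul, mul_assoc]).tsum_eq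

theorem sum_smul_regHom_shuffle_eq_zero {c : ι → mzvAlg}
    (h : ∑ i ∈ s, c i • regHom .harmonic (u i) = 0) :
    ∑ i ∈ s, c i • regHom .shuffle (u i) = 0 := by
  have htrunc := isModel_trunc.tendsto_sum_sub (s := s) (u := u) c
  simp only [h, map_zero, sub_zero] at htrunc
  refine eq_of_tendsto_sub_aeval isModel_polylogAt.tendsto (isModel_polylogAt.tendsto_sum_sub c) ?_
  simpa only [map_zero, sub_zero] using tendsto_sum_polylogAt htrunc

end Transfer

/-- The `𝒵`-linear comparison map `𝒵[T] → 𝒵[T]` of Ihara, Kaneko and Zagier, which carries `Z^∗` to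
`Z^ш`: it maps `T ^ n` to the `Z^ш`-image of the `n`-th harmonic power of `y`. -/
def comparison : mzvAlg[X] →ₗ[mzvAlg] mzvAlg[X] :=
  (Polynomial.basisMonomials mzvAlg).constr ℚ fun n =>
    regHom .shuffle ((harmonic (z [1]) ^ n) 1)

theorem comparison_X_pow (n : ℕ) :
    comparison (Polynomial.X ^ n) = regHom .shuffle ((harmonic (z [1]) ^ n) 1) := by
  rw [← Polynomial.monomial_one_right_eq_X_pow]
  exact Module.Basis.constr_basis _ ℚ _ n

theorem regHom_harmonic_y_pow (n : ℕ) :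
    regHom .harmonic ((harmonic (z [1]) ^ n) 1) = Polynomial.X ^ n := by
  induction n with
  | zero => exact (isRegularization_regHom .harmonic).map_one
  | succ n ih =>
    have h := (isRegularization_regHom .harmonic).map_prod (z [1]) ((harmonic (z [1]) ^ n) 1)
    rw [(isRegularization_regHom .harmonic).map_y, ih, ← pow_succ'] at h
    rw [pow_succ', Module.End.mul_apply]
    exact h

theorem comparison_regHom (w : H1) : comparison (regHom .harmonic w) = regHom .shuffle w := by
  set P := regHom .harmonic w with hP
  have hexp : P = ∑ n ∈ Finset.range (P.natDegree + 1), P.coeff n • Polynomial.X ^ n := by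
    simpa only [Polynomial.smul_eq_C_mul] using P.as_sum_range_C_mul_X_pow
  have h := sum_smul_regHom_shuffle_eq_zero
    (s := Finset.insertNone (Finset.range (P.natDegree + 1)))
    (u := fun n => n.elim w fun n => (harmonic (z [1]) ^ n) 1)
    (c := fun n => n.elim (-1) P.coeff) (by
      simp only [Finset.sum_insertNone, Option.elim_none, Option.elim_some, regHom_harmonic_y_pow,
        ← hP, ← hexp, neg_one_smul, neg_add_cancel])
  simp only [Finset.sum_insertNone, Option.elim_none, Option.elim_some, neg_one_smul,
    neg_add_eq_zero] at h
  rw [h]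
  nth_rw 1 [hexp]
  simp only [map_sum, map_smul, comparison_X_pow]

/-! ### The regularization theorem -/

/-- The Appell sequence `P` is biorthogonal to the functionals `L ∘ derivative^[j]`. -/
theorem eq_sum_smul_appell {R : Type*} [CommRing R] [IsAddTorsionFree R] {P : ℕ → R[X]}
    {L : R[X] →ₗ[R] R} (hP0 : P 0 = 1) (hP : ∀ j, Polynomial.derivative (P (j + 1)) = P j)
    (hL0 : L 1 = 1) (hL : ∀ j, L (P (j + 1)) = 0) {n : ℕ} {Q : R[X]}
    (hQ : (Polynomial.derivative^[n]) Q = 0) :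
    Q = ∑ j ∈ Finset.range n, L (Polynomial.derivative^[j] Q) • P j := by
  induction n generalizing Q with
  | zero => simpa using hQ
  | succ n ih =>
    set S := ∑ j ∈ Finset.range n, L (Polynomial.derivative^[j + 1] Q) • P (j + 1)
    have hS : Polynomial.derivative (Q - S) = 0 := by
      rw [Polynomial.derivative_sub, sub_eq_zero, ih hQ, Polynomial.derivative_sum]
      simp only [Polynomial.derivative_smul, hP]
      rfl
    obtain ⟨q, hq⟩ : ∃ q, Q - S = q • 1 :=
      ⟨_, (Polynomial.eq_C_of_derivative_eq_zero hS).trans (mul_one _).symm |>.trans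
        (Polynomial.smul_eq_C_mul _).symm⟩
    have hLS : L S = 0 := by simp [S, hL]
    have hLQ : L Q = q := by simpa [hLS, hL0] using congrArg L hq
    rw [Finset.sum_range_succ', Function.iterate_zero, id, hP0, hLQ, ← hq, add_sub_cancel]

/-- The monomial `yⁿ`. -/
def powY (n : ℕ) : H1 := zOne 1 ^ n

theorem powY_succ (n : ℕ) : powY (n + 1) = powY n * zOne 1 := pow_succ _ _

theorem powY_eq_z (n : ℕ) : powY n = z (List.replicate n 1) := by
  simp [powY, z]

theorem del_powY_succ (n : ℕ) : del (powY (n + 1)) = powY n := by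
  rw [powY_succ, del_mul_zOne, if_pos rfl]

/-- The homomorphism `Z^•` at `T = 0`. -/
def regConst (s : Kind) : H1 →ₗ[ℚ] mzvAlg :=
  (Polynomial.leval (0 : mzvAlg)).restrictScalars ℚ ∘ₗ regHom s

theorem regConst_apply (s : Kind) (w : H1) : regConst s w = (regHom s w).eval 0 := rfl

theorem regConst_z (s : Kind) (k : Index) : regConst s (z k) = zetaReg s k := rfl

theorem regConst_one (s : Kind) : regConst s 1 = 1 := by
  rw [regConst_apply, (isRegularization_regHom s).map_one, Polynomial.eval_one]

theorem regConst_prod_y (s : Kind) (w : H1) : regConst s (s.prod w (z [1])) = 0 := by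
  rw [regConst_apply, (isRegularization_regHom s).map_prod, (isRegularization_regHom s).map_y,
    Polynomial.eval_mul, Polynomial.eval_X, mul_zero]

theorem regHom_iterate_del (s : Kind) (j : ℕ) (w : H1) :
    regHom s ((del ^ j) w) = Polynomial.derivative^[j] (regHom s w) := by
  induction j with
  | zero => rfl
  | succ j ih =>
    rw [pow_succ', Module.End.mul_apply, ← (isRegularization_regHom s).derivative, ih,
      Function.iterate_succ_apply']

theorem shuffle_y_pow (n : ℕ) :
    shuffle (FreeAlgebra.ι ℚ Letter.y ^ n) (FreeAlgebra.ι ℚ Letter.y) =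
      (n + 1 : ℚ) • FreeAlgebra.ι ℚ Letter.y ^ (n + 1) := by
  have hmono (m : ℕ) : FreeAlgebra.ι ℚ Letter.y ^ m = mono (List.replicate m Letter.y).reverse := by
    simp [mono]
  induction n with
  | zero => simpa [mono_nil, mono_singleton] using shuffle_one_left [Letter.y]
  | succ n ih =>
    have h := shuffle_y Letter.y (List.replicate n Letter.y)
    rw [← List.replicate_succ, ← hmono, ← hmono, mono_singleton, ih, smul_mul_assoc,
      ← pow_succ] at h
    rw [h]
    push_cast
    module

theorem shuffleH1_powY (n : ℕ) : shuffleH1 (powY n) (z [1]) = (n + 1 : ℚ) • powY (n + 1) := by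
  have hcoe (m : ℕ) : (powY m : H) = FreeAlgebra.ι ℚ Letter.y ^ m := by
    rw [powY, SubmonoidClass.coe_pow, coe_zOne_one]
  refine Subtype.ext ?_
  change shuffle (powY n : H) (z [1] : H1) = (n + 1 : ℚ) • (powY (n + 1) : H)
  rw [hcoe, hcoe, z_singleton, coe_zOne_one, shuffle_y_pow]

theorem regConst_shuffle_powY_succ (n : ℕ) : regConst .shuffle (powY (n + 1)) = 0 := by
  have h : regConst .shuffle (shuffleH1 (powY n) (z [1])) = 0 := regConst_prod_y .shuffle (powY n)
  rw [shuffleH1_powY, map_smul] at h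
  exact (smul_eq_zero.1 h).resolve_left (by positivity)

theorem regConst_harmonic_eq_sum {w : H1} {n : ℕ} (hw : (del ^ n) w = 0) :
    regConst .harmonic w =
      ∑ j ∈ Finset.range n, regConst .shuffle ((del ^ j) w) * regConst .harmonic (powY j) := by
  let L : mzvAlg[X] →ₗ[mzvAlg] mzvAlg := Polynomial.leval 0 ∘ₗ comparison
  have hL (u : H1) : L (regHom .harmonic u) = regConst .shuffle u :=
    congrArg (Polynomial.eval 0) (comparison_regHom u)
  have hreg := isRegularization_regHom .harmonic
  have h := eq_sum_smul_appell (P := fun j => regHom .harmonic (powY j)) (L := L)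
    (Q := regHom .harmonic w) (n := n) hreg.map_one
    (fun j => by rw [hreg.derivative, del_powY_succ])
    (by rw [← hreg.map_one, hL, regConst_one])
    (fun j => by rw [hL, regConst_shuffle_powY_succ])
    (by rw [← regHom_iterate_del, hw, map_zero])
  simpa only [← regHom_iterate_del, hL, Polynomial.eval_finsetSum, Polynomial.eval_smul,
    smul_eq_mul, ← regConst_apply] using congrArg (Polynomial.eval 0) h

/-! ### The generating function of `ζ^∗(1, …, 1)` -/

theorem powY_zero : powY 0 = 1 := pow_zero _

theorem harmonic_zOne_powY_zero (a : ℕ+) : harmonic (zOne a) (powY 0) = zOne a := by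
  rw [← z_singleton, powY_eq_z, List.replicate_zero, harmonic_one_right]

theorem harmonic_zOne_powY_succ (a : ℕ+) (m : ℕ) :
    harmonic (zOne a) (powY (m + 1)) =
      powY (m + 1) * zOne a + harmonic (zOne a) (powY m) * zOne 1 + powY m * zOne (a + 1) := by
  have h := harmonic_mul [] (List.replicate m 1) a 1
  rwa [← powY_eq_z, ← powY_succ, powY_eq_z (m + 1), harmonic_one_left, ← powY_eq_z, powY_eq_z m,
    harmonic_one_left, ← powY_eq_z, z_nil, one_mul] at h

theorem sum_powY_mul_zOne (n : ℕ) :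
    ∑ p ∈ Finset.HasAntidiagonal.antidiagonal (n + 1),
        (-1 : ℚ) ^ p.1 • (powY p.2 * zOne p.1.succPNat) +
      ∑ p ∈ Finset.HasAntidiagonal.antidiagonal n,
        (-1 : ℚ) ^ p.1 • (powY p.2 * zOne (p.1.succPNat + 1)) =
      powY (n + 2) := by
  rw [Finset.Nat.sum_antidiagonal_succ, add_assoc, ← Finset.sum_add_distrib,
    Finset.sum_eq_zero fun p _ => ?_, add_zero, pow_zero, one_smul, powY_succ]
  · rfl
  · rw [pow_succ, mul_neg_one, neg_smul]
    exact neg_add_cancel _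

/-- Newton's identity between elementary symmetric functions and power sums. -/
theorem sum_harmonic_zOne_powY (n : ℕ) :
    ∑ p ∈ Finset.HasAntidiagonal.antidiagonal n,
        (-1 : ℚ) ^ p.1 • harmonic (zOne p.1.succPNat) (powY p.2) =
      (n + 1 : ℚ) • powY (n + 1) := by
  induction n with
  | zero =>
    rw [Finset.HasAntidiagonal.antidiagonal_zero, Finset.sum_singleton, harmonic_zOne_powY_zero,
      powY_succ, powY_zero, one_mul]
    simp [Nat.succPNat]
  | succ n ih =>
    have hB := sum_powY_mul_zOne n
    rw [Finset.Nat.sum_antidiagonal_succ', powY_zero, one_mul] at hB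
    rw [Finset.Nat.sum_antidiagonal_succ']
    simp only [harmonic_zOne_powY_zero, harmonic_zOne_powY_succ, smul_add, Finset.sum_add_distrib,
      ← smul_mul_assoc, ← Finset.sum_mul, ih] at hB ⊢
    rw [smul_mul_assoc, ← powY_succ, ← hB]
    push_cast
    module

/-- The generating function of `ζ^∗(1, …, 1)`. -/
def onesSeries : mzvAlg⟦X⟧ := PowerSeries.mk fun j => regConst .harmonic (powY j)

/-- The generating function of the signed single zeta values `(-1)ⁱ ζ^∗(i + 1)`. -/
def powerSumSeries : mzvAlg⟦X⟧ :=
  PowerSeries.mk fun i => (-1) ^ i * regConst .harmonic (zOne i.succPNat)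

theorem derivative_onesSeries : d⁄dX mzvAlg onesSeries = powerSumSeries * onesSeries := by
  ext1 n
  have h := congrArg (regConst .harmonic) (sum_harmonic_zOne_powY n)
  have hprod (u v : H1) : regConst .harmonic (harmonic u v) =
      regConst .harmonic u * regConst .harmonic v := by
    simp only [regConst_apply, ← Polynomial.eval_mul]
    exact congrArg _ ((isRegularization_regHom .harmonic).map_prod u v)
  simp only [map_sum, map_smul, hprod] at h
  simp only [Algebra.smul_def, map_add, map_natCast, map_one, map_pow, map_neg] at h
  rw [PowerSeries.coeff_derivative, PowerSeries.coeff_mul, mul_comm]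
  simpa only [onesSeries, powerSumSeries, PowerSeries.coeff_mk, mul_assoc] using h.symm

theorem constantCoeff_onesSeries : PowerSeries.constantCoeff onesSeries = 1 := by
  simp [onesSeries, powY, regConst_one]

theorem exists_mzv_even (i : ℕ) :
    ∃ q : ℚ, mzv [(2 * i + 1).succPNat] = q * Real.pi ^ (2 * (i + 1)) := by
  have hzeta := (hasSum_nat_add_iff' 1).2 (hasSum_zeta_nat i.succ_ne_zero)
  rw [Finset.sum_range_one, Nat.cast_zero, zero_pow (by positivity), div_zero, sub_zero] at hzeta
  refine ⟨(-1) ^ (i + 1 + 1) * 2 ^ (2 * (i + 1) - 1) * bernoulli (2 * (i + 1)) /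
    (2 * (i + 1)).factorial, ?_⟩
  have hmzv := hasSum_mzv (a := (2 * i + 1).succPNat) (by simp [← PNat.coe_eq_one_iff]) []
  rw [List.reverse_singleton] at hmzv
  have h := hmzv.unique (hzeta.congr_fun fun n => by
    rw [hsum_nil, Nat.succPNat_coe]
    push_cast
    rfl)
  rw [h, Nat.succ_eq_add_one]
  push_cast
  ring

theorem regConst_zOne_mem {i : ℕ} (hi : Odd i) :
    regConst .harmonic (zOne i.succPNat) ∈ piSqIdeal := by
  obtain ⟨j, rfl⟩ := hi
  have hadm : Admissible [(2 * j + 1).succPNat] := by simp [Admissible]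
  obtain ⟨q, hq⟩ := exists_mzv_even j
  have h : mzvZ _ hadm = algebraMap ℚ mzvAlg q * piSq ^ j * piSq := by
    refine Subtype.ext ?_
    change mzv _ = (q : ℝ) * (Real.pi ^ 2) ^ j * Real.pi ^ 2
    rw [hq]
    ring
  rw [← z_singleton, regConst_apply, (isRegularization_regHom _).map_admissible _ hadm,
    Polynomial.eval_C, h]
  exact Ideal.mul_mem_left _ _ (Ideal.mem_span_singleton_self _)

section EvalNeg

variable {A : Type*} [CommRing A]

theorem evalNegHom_eq_self {p : A⟦X⟧} (hp : ∀ i, Odd i → PowerSeries.coeff i p = 0) :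
    PowerSeries.evalNegHom p = p := by
  ext i
  rw [PowerSeries.evalNegHom, PowerSeries.coeff_rescale]
  rcases Nat.even_or_odd i with hi | hi
  · rw [hi.neg_one_pow, one_mul]
  · rw [hp i hi, mul_zero]

theorem derivative_evalNegHom (f : A⟦X⟧) :
    d⁄dX A (PowerSeries.evalNegHom f) = -PowerSeries.evalNegHom (d⁄dX A f) := by
  ext n
  simp only [PowerSeries.evalNegHom, PowerSeries.coeff_derivative, PowerSeries.coeff_rescale,
    map_neg, pow_succ]
  ring

/-- A solution of `f' = p f` with `p` even is the exponential of an odd series. -/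
theorem mul_evalNegHom_eq_one [IsAddTorsionFree A] {f p : A⟦X⟧}
    (hf : d⁄dX A f = p * f) (hp : PowerSeries.evalNegHom p = p)
    (hf0 : PowerSeries.constantCoeff f = 1) : f * PowerSeries.evalNegHom f = 1 := by
  refine PowerSeries.derivative.ext ?_ ?_
  · rw [PowerSeries.derivative_one, Derivation.leibniz, derivative_evalNegHom, hf, map_mul, hp,
      smul_eq_mul, smul_eq_mul]
    ring
  · rw [map_mul, map_one, hf0, one_mul, ← PowerSeries.coeff_zero_eq_constantCoeff_apply,
      PowerSeries.evalNegHom, PowerSeries.coeff_rescale, pow_zero, one_mul,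
      PowerSeries.coeff_zero_eq_constantCoeff_apply, hf0]

end EvalNeg

theorem map_onesSeries_mul_evalNegHom :
    onesSeries.map (Ideal.Quotient.mk piSqIdeal) *
      PowerSeries.evalNegHom (onesSeries.map (Ideal.Quotient.mk piSqIdeal)) = 1 := by
  have : IsAddTorsionFree (mzvAlg ⧸ piSqIdeal) := .of_module_rat _
  refine mul_evalNegHom_eq_one (p := powerSumSeries.map (Ideal.Quotient.mk piSqIdeal)) ?_
    (evalNegHom_eq_self fun i hi => ?_) ?_
  · rw [← map_mul, ← derivative_onesSeries]
    ext n
    simp [PowerSeries.coeff_derivative]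
  · rw [PowerSeries.coeff_map, powerSumSeries, PowerSeries.coeff_mk, map_mul,
      Ideal.Quotient.eq_zero_iff_mem.2 (regConst_zOne_mem hi), mul_zero]
  · rw [← PowerSeries.coeff_zero_eq_constantCoeff_apply, PowerSeries.coeff_map,
      PowerSeries.coeff_zero_eq_constantCoeff_apply, constantCoeff_onesSeries, map_one]

/-! ### Removing leading ones -/

section StripOne

variable {R M M' : Type*} [CommRing R] [AddCommGroup M] [Module R M] [AddCommGroup M']
  [Module R M']

/-- The operator on functions of an index that evaluates at the index with its leading entry `1`
removed, and is zero where there is none. Indices are reversed here, so that it corresponds to `∂`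
on `𝔥¹`. -/
def stripOne (R M : Type*) [CommRing R] [AddCommGroup M] [Module R M] :
    Module.End R (List ℕ+ → M) where
  toFun f
    | [] => 0
    | c :: r => if c = 1 then f r else 0
  map_add' f g := funext fun
    | [] => (add_zero 0).symm
    | c :: r => by
      dsimp only [Pi.add_apply]
      split_ifs <;> simp
  map_smul' a f := funext fun
    | [] => (smul_zero a).symm
    | c :: r => by
      dsimp only [Pi.smul_apply, RingHom.id_apply]
      split_ifs <;> simp

theorem stripOne_nil (f : List ℕ+ → M) : stripOne R M f [] = 0 := rfl

theorem stripOne_cons (f : List ℕ+ → M) (c : ℕ+) (r : List ℕ+) :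
    stripOne R M f (c :: r) = if c = 1 then f r else 0 := rfl

theorem stripOne_pow_apply_eq_zero (f : List ℕ+ → M) {r : List ℕ+} {n : ℕ} (h : r.length < n) :
    (stripOne R M ^ n) f r = 0 := by
  induction n generalizing r with
  | zero => omega
  | succ n ih =>
    rw [pow_succ', Module.End.mul_apply]
    cases r with
    | nil => rfl
    | cons c r => rw [stripOne_cons, ih (by simpa using h), ite_self]

theorem aeval_stripOne_apply_eq_zero (f : List ℕ+ → M) {r : List ℕ+} {n : ℕ} {p : R[X]}
    (hp : Polynomial.X ^ n ∣ p) (h : r.length < n) :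
    Polynomial.aeval (stripOne R M) p f r = 0 := by
  obtain ⟨q, rfl⟩ := hp
  rw [map_mul, map_pow, Polynomial.aeval_X, Module.End.mul_apply, stripOne_pow_apply_eq_zero _ h]

theorem map_aeval_of_map {φ : M →ₗ[R] M'} {S : Module.End R M} {S' : Module.End R M'}
    (h : ∀ x, φ (S x) = S' (φ x)) (p : R[X]) (x : M) :
    φ (Polynomial.aeval S p x) = Polynomial.aeval S' p (φ x) := by
  induction p using Polynomial.induction_on generalizing x with
  | C a => simp
  | add p q hp hq => simp only [map_add, LinearMap.add_apply, hp, hq]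
  | monomial n a ih =>
    simp only [pow_succ, ← mul_assoc, map_mul _ (_ * _), Polynomial.aeval_X, Module.End.mul_apply,
      ih, h]

theorem aeval_trunc_apply (S : Module.End R M) (n : ℕ) (φ : R⟦X⟧) (x : M) :
    Polynomial.aeval S (PowerSeries.trunc n φ) x =
      ∑ j ∈ Finset.range n, PowerSeries.coeff j φ • (S ^ j) x := by
  simp only [Polynomial.aeval_def, PowerSeries.eval₂_trunc_eq_sum_range, LinearMap.sum_apply,
    ← Algebra.smul_def, LinearMap.smul_apply]

theorem comp_stripOne (φ : M →ₗ[R] M') (f : List ℕ+ → M) :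
    φ ∘ stripOne R M f = stripOne R M' (φ ∘ f) := funext fun
  | [] => map_zero φ
  | c :: r => by
    simp only [Function.comp_apply, stripOne_cons]
    split_ifs <;> simp

theorem comp_aeval_stripOne (φ : M →ₗ[R] M') (p : R[X]) (f : List ℕ+ → M) :
    φ ∘ Polynomial.aeval (stripOne R M) p f = Polynomial.aeval (stripOne R M') p (φ ∘ f) :=
  map_aeval_of_map (φ := φ.compLeft (List ℕ+)) (comp_stripOne φ) p f

end StripOne

section CutSum

variable {R A : Type*} [CommRing R] [CommRing A] [Algebra R A]

/-- The signed sum `∑ᵢ (-1)^{wt(k^{[i]})} F(k_{[i]}) G(k^{[i]})` over all ways to cut the index `k`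
into two parts, where `F` is evaluated at reversed indices. -/
def cutSum (R : Type*) {A : Type*} [CommRing R] [CommRing A] [Algebra R A] (k : Index) :
    LinearMap.BilinMap R (List ℕ+ → A) A :=
  ∑ i ∈ Finset.range (k.length + 1), (-1 : R) ^ wt (k.drop i) •
    (LinearMap.mul R A).compl₁₂ (LinearMap.proj (k.take i).reverse) (LinearMap.proj (k.drop i))

theorem cutSum_apply (k : Index) (F G : List ℕ+ → A) :
    cutSum R k F G = ∑ i ∈ Finset.range (k.length + 1),
      (-1) ^ wt (k.drop i) * F (k.take i).reverse * G (k.drop i) := by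
  simp [cutSum, Algebra.smul_def, mul_assoc]

theorem cutSum_congr {k : Index} {F F' G G' : List ℕ+ → A}
    (hF : ∀ r : List ℕ+, r.length ≤ k.length → F r = F' r)
    (hG : ∀ r : List ℕ+, r.length ≤ k.length → G r = G' r) :
    cutSum R k F G = cutSum R k F' G' := by
  simp only [cutSum_apply]
  refine Finset.sum_congr rfl fun i _ => ?_
  rw [hF _ (by simp), hG _ (by simp)]

theorem cutSum_stripOne (k : Index) (F G : List ℕ+ → A) :
    cutSum R k (stripOne R A F) G = cutSum R k F ((-stripOne R A) G) := by
  rw [LinearMap.neg_apply, map_neg, cutSum_apply, cutSum_apply, Finset.sum_range_succ',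
    Finset.sum_range_succ, List.take_zero, List.reverse_nil, List.drop_length, stripOne_nil,
    stripOne_nil, mul_zero, zero_mul, mul_zero, add_zero, add_zero, ← Finset.sum_neg_distrib]
  refine Finset.sum_congr rfl fun i hi => ?_
  have hi : i < k.length := Finset.mem_range.1 hi
  rw [List.drop_eq_getElem_cons hi, ← List.take_append_getElem hi, List.reverse_append,
    List.reverse_singleton, List.singleton_append, stripOne_cons, stripOne_cons]
  split_ifs with hc
  · have hwt : wt (k[i] :: k.drop (i + 1)) = wt (k.drop (i + 1)) + 1 := by
      simp [wt, hc, add_comm]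
    rw [hwt, pow_succ]
    ring
  · simp

theorem cutSum_aeval_stripOne (k : Index) (p : R[X]) (F G : List ℕ+ → A) :
    cutSum R k (Polynomial.aeval (stripOne R A) p F) G =
      cutSum R k F (Polynomial.aeval (-stripOne R A) p G) := by
  induction p using Polynomial.induction_on generalizing F G with
  | C a => simp
  | add p q hp hq => simp only [map_add, LinearMap.add_apply, hp, hq]
  | monomial n a ih =>
    have hX (S : Module.End R (List ℕ+ → A)) (q : R[X]) (H : List ℕ+ → A) :
        Polynomial.aeval S (Polynomial.X * q) H = S (Polynomial.aeval S q H) := by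
      rw [map_mul, Polynomial.aeval_X, Module.End.mul_apply]
    have hX' (S : Module.End R (List ℕ+ → A)) (q : R[X]) (H : List ℕ+ → A) :
        Polynomial.aeval S (q * Polynomial.X) H = Polynomial.aeval S q (S H) := by
      rw [map_mul, Polynomial.aeval_X, Module.End.mul_apply]
    rw [pow_succ, ← mul_assoc, mul_comm, hX, cutSum_stripOne, ih, ← hX', mul_comm]

theorem X_pow_dvd_trunc_mul_comp_sub_one {φ : R⟦X⟧} (hφ : φ * PowerSeries.evalNegHom φ = 1)
    (n : ℕ) :
    Polynomial.X ^ n ∣ PowerSeries.trunc n φ *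
      (PowerSeries.trunc n φ).comp (Polynomial.C (-1) * Polynomial.X) - 1 := by
  have hcomp : (PowerSeries.trunc n φ).comp (Polynomial.C (-1) * Polynomial.X) =
      PowerSeries.trunc n (PowerSeries.evalNegHom φ) := by
    ext d
    rw [Polynomial.comp_C_mul_X_coeff, PowerSeries.coeff_trunc, PowerSeries.coeff_trunc,
      PowerSeries.evalNegHom, PowerSeries.coeff_rescale, ite_mul, zero_mul, mul_comm]
  refine Polynomial.X_pow_dvd_iff.2 fun d hd => ?_
  rw [hcomp, Polynomial.coeff_sub, ← Polynomial.coeff_coe, Polynomial.coe_mul,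
    ← PowerSeries.coeff_mul_eq_coeff_trunc_mul_trunc _ _ hd, hφ, ← Polynomial.coeff_coe,
    Polynomial.coe_one, sub_self]

theorem cutSum_aeval_trunc {φ : R⟦X⟧} (hφ : φ * PowerSeries.evalNegHom φ = 1) (k : Index)
    (F G : List ℕ+ → A) :
    cutSum R k (Polynomial.aeval (stripOne R A) (PowerSeries.trunc (k.length + 1) φ) F)
      (Polynomial.aeval (stripOne R A) (PowerSeries.trunc (k.length + 1) φ) G) =
    cutSum R k F G := by
  set p := PowerSeries.trunc (k.length + 1) φ
  have hneg : Polynomial.aeval (-stripOne R A) p =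
      Polynomial.aeval (stripOne R A) (p.comp (Polynomial.C (-1) * Polynomial.X)) := by
    rw [Polynomial.aeval_comp]
    simp
  rw [cutSum_aeval_stripOne, hneg, ← Module.End.mul_apply, ← map_mul, mul_comm]
  refine cutSum_congr (fun _ _ => rfl) fun r hr => ?_
  have h := aeval_stripOne_apply_eq_zero G (X_pow_dvd_trunc_mul_comp_sub_one hφ (k.length + 1))
    (Nat.lt_succ_of_le hr)
  rwa [map_sub, map_one, LinearMap.sub_apply, Pi.sub_apply, Module.End.one_apply, sub_eq_zero] at h

end CutSum

section ShiftSeries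

variable {R : Type*} [CommRing R]

/-- The series `∑_l b(k, l) f(k + l) t^{wt l}`. -/
def shiftSeries (R : Type*) [CommRing R] : (List ℕ+ → R) →ₗ[R] (List ℕ+ → R⟦X⟧) where
  toFun f k := PowerSeries.mk fun n => ∑ l ∈ Finset.Nat.antidiagonalTuple k.length n,
    (Index.b k l : R) * f (Index.shift k l)
  map_add' f g := by
    ext k n
    simp only [Pi.add_apply, map_add, PowerSeries.coeff_mk, mul_add, Finset.sum_add_distrib]
  map_smul' a f := by
    ext k n
    simp only [Pi.smul_apply, map_smul, PowerSeries.coeff_mk, smul_eq_mul, RingHom.id_apply,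
      Finset.mul_sum, mul_left_comm]

theorem coeff_shiftSeries (f : List ℕ+ → R) (k : Index) (n : ℕ) :
    PowerSeries.coeff n (shiftSeries R f k) =
      ∑ l ∈ Finset.Nat.antidiagonalTuple k.length n, (Index.b k l : R) * f (Index.shift k l) := by
  simp only [shiftSeries, LinearMap.coe_mk, AddHom.coe_mk, PowerSeries.coeff_mk]

theorem shiftSeries_congr {f g : List ℕ+ → R} {k : Index}
    (h : ∀ r : List ℕ+, r.length = k.length → f r = g r) :
    shiftSeries R f k = shiftSeries R g k := by
  ext n
  simp only [coeff_shiftSeries]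
  exact Finset.sum_congr rfl fun l _ => congrArg _ (h _ List.length_ofFn)

/-- The positive integer `c + n`. -/
def addNat (c : ℕ+) (n : ℕ) : ℕ+ := ⟨c + n, Nat.add_pos_left c.pos n⟩

theorem addNat_eq_one_iff {c : ℕ+} {n : ℕ} : addNat c n = 1 ↔ c = 1 ∧ n = 0 := by
  have := c.pos
  rw [← PNat.coe_eq_one_iff (m := c), ← PNat.coe_eq_one_iff, addNat, PNat.mk_coe]
  omega

theorem shift_cons (c : ℕ+) (k : Index) (l : Fin (k.length + 1) → ℕ) :
    Index.shift (c :: k) l = addNat c (l 0) :: Index.shift k (Fin.tail l) :=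
  List.ofFn_succ

theorem b_cons (c : ℕ+) (k : Index) (l : Fin (k.length + 1) → ℕ) :
    Index.b (c :: k) l = Nat.choose ((c : ℕ) + l 0 - 1) (l 0) * Index.b k (Fin.tail l) :=
  Fin.prod_univ_succ _

theorem sum_antidiagonalTuple_head_zero {M : Type*} [AddCommMonoid M] (r n : ℕ)
    (g : (Fin r → ℕ) → M) :
    ∑ l ∈ Finset.Nat.antidiagonalTuple (r + 1) n, (if l 0 = 0 then g (Fin.tail l) else 0) =
      ∑ l ∈ Finset.Nat.antidiagonalTuple r n, g l := by
  rw [← Finset.sum_filter]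
  refine Finset.sum_nbij' Fin.tail (Fin.cons (α := fun _ => ℕ) 0) ?_ ?_ ?_ ?_ fun _ _ => rfl
  · intro l hl
    rw [Finset.mem_filter, Finset.Nat.mem_antidiagonalTuple, Fin.sum_univ_succ] at hl
    rw [Finset.Nat.mem_antidiagonalTuple, ← hl.1, hl.2, zero_add]
    rfl
  · intro l hl
    rw [Finset.Nat.mem_antidiagonalTuple] at hl
    rw [Finset.mem_filter, Finset.Nat.mem_antidiagonalTuple, Fin.sum_univ_succ]
    simp [hl]
  · intro l hl
    rw [← (Finset.mem_filter.1 hl).2]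
    exact Fin.cons_self_tail l
  · exact fun l _ => Fin.tail_cons _ _

theorem b_mul_stripOne_shift_cons (f : List ℕ+ → R) (c : ℕ+) (k : Index)
    (l : Fin (k.length + 1) → ℕ) :
    (Index.b (c :: k) l : R) * stripOne R R f (Index.shift (c :: k) l) =
      if c = 1 then if l 0 = 0 then (Index.b k (Fin.tail l) : R) * f (Index.shift k (Fin.tail l))
        else 0 else 0 := by
  rw [shift_cons, stripOne_cons, ← ite_and, mul_ite, mul_zero]
  simp only [addNat_eq_one_iff]
  refine if_ctx_congr Iff.rfl (fun h => ?_) fun _ => rfl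
  rw [b_cons, h.2, Nat.choose_zero_right, one_mul]

theorem shiftSeries_stripOne (f : List ℕ+ → R) :
    shiftSeries R (stripOne R R f) = stripOne R R⟦X⟧ (shiftSeries R f) := by
  ext k n
  rw [coeff_shiftSeries]
  cases k with
  | nil => exact Finset.sum_eq_zero fun _ _ => mul_zero _
  | cons c k =>
    refine (Finset.sum_congr rfl fun l _ => b_mul_stripOne_shift_cons f c k l).trans ?_
    rw [stripOne_cons]
    split_ifs
    · rw [coeff_shiftSeries]
      exact sum_antidiagonalTuple_head_zero k.length n fun l =>
        (Index.b k l : R) * f (Index.shift k l)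
    · exact Finset.sum_const_zero

end ShiftSeries

/-! ### Independence of the regularization -/

/-- The values `ζ^•(k)` modulo `π²`, as a function of the reversed index. -/
def zetaRegBar (s : Kind) (r : List ℕ+) : mzvAlg ⧸ piSqIdeal :=
  Ideal.Quotient.mk piSqIdeal (zetaReg s r.reverse)

theorem zetaSBar_eq_cutSum (s : Kind) (k : Index) :
    zetaSBar s k = cutSum (mzvAlg ⧸ piSqIdeal) k
      (Algebra.linearMap (mzvAlg ⧸ piSqIdeal) (mzvAlg ⧸ piSqIdeal)⟦X⟧ ∘ zetaRegBar s)
      (shiftSeries (mzvAlg ⧸ piSqIdeal) (zetaRegBar s)) := by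
  have htail (k : Index) : (tailSeries s k).map (Ideal.Quotient.mk piSqIdeal) =
      shiftSeries _ (zetaRegBar s) k := by
    ext n
    simp [tailSeries, coeff_shiftSeries, zetaRegBar]
  simp [zetaSBar, zetaS, cutSum_apply, htail, zetaRegBar]

theorem stripOne_comp_z {R M : Type*} [CommRing R] [AddCommGroup M] [Module R M] [Module ℚ M]
    (g : H1 →ₗ[ℚ] M) :
    stripOne R M (fun r => g (z r.reverse)) = fun r => g (del (z r.reverse)) := funext fun
  | [] => by rw [stripOne_nil, List.reverse_nil, z_nil, del_one, map_zero]
  | c :: r => by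
    rw [stripOne_cons, z_reverse_cons, del_mul_zOne]
    split_ifs <;> simp

theorem stripOne_pow_comp_z {R M : Type*} [CommRing R] [AddCommGroup M] [Module R M] [Module ℚ M]
    (g : H1 →ₗ[ℚ] M) (j : ℕ) :
    (stripOne R M ^ j) (fun r => g (z r.reverse)) = fun r => g ((del ^ j) (z r.reverse)) := by
  induction j generalizing g with
  | zero => rfl
  | succ j ih =>
    rw [pow_succ, Module.End.mul_apply, stripOne_comp_z g, pow_succ']
    exact ih (g ∘ₗ del)

theorem zetaRegBar_harmonic_eq {r : List ℕ+} {n : ℕ} (h : r.length < n) :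
    zetaRegBar .harmonic r =
      Polynomial.aeval (stripOne (mzvAlg ⧸ piSqIdeal) (mzvAlg ⧸ piSqIdeal))
        (PowerSeries.trunc n (onesSeries.map (Ideal.Quotient.mk piSqIdeal)))
        (zetaRegBar .shuffle) r := by
  have hstrip (j : ℕ) : (stripOne (mzvAlg ⧸ piSqIdeal) _ ^ j) (zetaRegBar .shuffle) r =
      Ideal.Quotient.mk piSqIdeal (regConst .shuffle ((del ^ j) (z r.reverse))) :=
    congrFun (stripOne_pow_comp_z
      ((Ideal.Quotient.mkₐ ℚ piSqIdeal).toLinearMap ∘ₗ regConst .shuffle) j) r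
  have hdel : (del ^ n) (z r.reverse) = 0 := by
    rw [← Nat.sub_add_cancel (Nat.succ_le_of_lt h), pow_add, Module.End.mul_apply, del_pow_z,
      map_zero]
  rw [zetaRegBar, ← regConst_z, regConst_harmonic_eq_sum hdel, map_sum, aeval_trunc_apply,
    Finset.sum_apply]
  refine Finset.sum_congr rfl fun j _ => ?_
  rw [Pi.smul_apply, hstrip, PowerSeries.coeff_map, onesSeries, PowerSeries.coeff_mk, map_mul,
    smul_eq_mul, mul_comm]

theorem zetaSBar_harmonic_eq_shuffle (k : Index) : zetaSBar .harmonic k = zetaSBar .shuffle k := by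
  rw [zetaSBar_eq_cutSum, zetaSBar_eq_cutSum]
  refine .trans ?_ (cutSum_aeval_trunc map_onesSeries_mul_evalNegHom k _ _)
  set p := PowerSeries.trunc (k.length + 1) (onesSeries.map (Ideal.Quotient.mk piSqIdeal))
  refine cutSum_congr (fun r hr => ?_) fun r hr => ?_
  · rw [Function.comp_apply, zetaRegBar_harmonic_eq (Nat.lt_succ_of_le hr)]
    exact congrFun (comp_aeval_stripOne _ p _) r
  · rw [← map_aeval_of_map shiftSeries_stripOne]
    exact shiftSeries_congr fun l hl => zetaRegBar_harmonic_eq (by omega)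

theorem mem_span_C_of_map_mk_eq_zero {R : Type*} [CommRing R] {a : R} {f : R⟦X⟧}
    (h : f.map (Ideal.Quotient.mk (Ideal.span {a})) = 0) : f ∈ Ideal.span {PowerSeries.C a} := by
  have hdvd (n : ℕ) : a ∣ PowerSeries.coeff n f := by
    rw [← Ideal.mem_span_singleton, ← Ideal.Quotient.eq_zero_iff_mem, ← PowerSeries.coeff_map, h,
      map_zero]
  choose g hg using hdvd
  refine Ideal.mem_span_singleton.2 ⟨PowerSeries.mk g, ?_⟩
  ext n
  rw [PowerSeries.coeff_C_mul, PowerSeries.coeff_mk, hg]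

theorem zetaS_sub_mem_piSqIdealSeries (k : Index) :
    zetaS .harmonic k - zetaS .shuffle k ∈ piSqIdealSeries :=
  mem_span_C_of_map_mk_eq_zero (by rw [map_sub, sub_eq_zero]; exact zetaSBar_harmonic_eq_shuffle k)

end SymMZV

end

theorem proposition2p1 :
    (∀ s : SymMZV.Kind, ∃! Z, SymMZV.IsRegularization s Z) ∧
    (∀ k : SymMZV.Index,
      SymMZV.zetaS .harmonic k - SymMZV.zetaS .shuffle k ∈ SymMZV.piSqIdealSeries) ∧
    (∀ k : SymMZV.Index, SymMZV.zetaSBar .harmonic k = SymMZV.zetaSBar .shuffle k) := by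
  refine ⟨fun s => ?_, SymMZV.zetaS_sub_mem_piSqIdealSeries, SymMZV.zetaSBar_harmonic_eq_shuffle⟩
  obtain ⟨Z, hZ⟩ := SymMZV.exists_isRegularization s
  exact ⟨Z, hZ, fun _ h => h.unique hZ⟩
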